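/- **Setting.** Fix a set of propositional variables $p$ and a set of atomic programs $\alpha$. Formulas and programs of propositional dynamic logic are given by $$\varphi ::= \bot \mid p \mid \varphi\to\varphi \mid [\pi]\varphi, \qquad \pi ::= \alpha \mid \pi;\pi \mid \pi\cup\pi \mid \pi^{*} \mid \varphi?.$$ A sequent $\Gamma\vdash\Delta$ is a pair of finite sets of formulas; commas denote union, and $[\pi]\Gamma=\{[\pi]\psi : \psi\in\Gamma\}$. **Rules of $\mathtt{CGPDL}$** (assumptions / conclusion): - (Ax) $\ /\ \Gamma\vdash\Delta$ if $\Gamma\cap\Delta\neq\emptyset$; ($\bot$) $\ /\ \Gamma,\bot\vdash\Delta$; - ($\to$L) $\Gamma\vdash\varphi,\Delta$ and $\Gamma,\psi\vdash\Delta\ /\ \Gamma,\varphi\to\psi\vdash\Delta$; ($\to$R) $\Gamma,\varphi\vdash\psi,\Delta\ /\ \Gamma\vdash\varphi\to\psi,\Delta$; - (Wk) $\Gamma\vdash\Delta\ /\ \Gamma'\vdash\Delta'$ if $\Gamma\subseteq\Gamma'$ and $\Delta\subseteq\Delta'$; (Cut) $\Gamma\vdash\varphi,\Delta$ and $\Gamma,\varphi\vdash\Delta\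 /\ \Gamma\vdash\Delta$; - (K) $\Gamma\vdash\varphi\ /\ \Gamma',[\pi]\Gamma\vdash[\pi]\varphi,\Delta$; - ($;$L) $\Gamma,[\pi_0][\pi_1]\varphi\vdash\Delta\ /\ \Gamma,[\pi_0;\pi_1]\varphi\vdash\Delta$; ($;$R) $\Gamma\vdash[\pi_0][\pi_1]\varphi,\Delta\ /\ \Gamma\vdash[\pi_0;\pi_1]\varphi,\Delta$; - ($\cup$L) $\Gamma,[\pi_0]\varphi,[\pi_1]\varphi\vdash\Delta\ /\ \Gamma,[\pi_0\cup\pi_1]\varphi\vdash\Delta$; ($\cup$R) $\Gamma\vdash[\pi_0]\varphi,\Delta$ and $\Gamma\vdash[\pi_1]\varphi,\Delta\ /\ \Gamma\vdash[\pi_0\cup\pi_1]\varphi,\Delta$; - ($*$L) $\Gamma,\varphi,[\pi][\pi^*]\varphi\vdash\Delta\ /\ \Gamma,[\pi^*]\varphi\vdash\Delta$; (C-s) $\Gamma\vdash\varphi,\Delta$ and $\Gamma\vdash[\pi][\pi^*]\varphi,\Delta\ /\ \Gamma\vdash[\pi^*]\varphi,\Delta$; - ($?$L) $\Gamma\vdash\varphi,\Delta$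 and $\Gamma,\psi\vdash\Delta\ /\ \Gamma,[\varphi?]\psi\vdash\Delta$; ($?$R) $\Gamma,\varphi\vdash\psi,\Delta\ /\ \Gamma\vdash[\varphi?]\psi,\Delta$. **Proofs.** A *derivation tree* is a finite tree of sequents each of whose nodes either is the conclusion of an instance of a rule whose assumptions label its children, or is a leaf that is not the conclusion of a rule (a *bud*). A *pre-proof* is a derivation tree together with a map sending each bud to a *companion*: an inner (non-leaf) node labelled by the same sequent. Its *derivation graph* is obtained by identifying each bud with its companion. An infinite path in it is an infinite sequence of nodes each of which, after the first, is reached from the previous one through one chosen assumption of the rule instance at the previous one. A *trace* following an infinite path $(\Gamma_i\vdash\Delta_i)_{i\ge k}$ is a sequence of formulas $\tau_i\in\Delta_i$ such that, for every $i$: if the rule at $i$ is (K), then $\tau_i$ is its principal formula $[\pi]\varphi$ and $\tau_{i+1}=\varphi$; if it is ($\to$R), ($;$R), ($\cup$R), ($?$R) or (C-s), then either $\tau_{i+1}=\tau_i$, or $\tau_i$ is the principal formula and $\tau_{i+1}$ is the formula that replaces it in the assumption through which the path passes (that is, $\psi$ for $\varphi\to\psi$ and for $[\varphi?]\psi$;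 $[\pi_0][\pi_1]\varphi$ for $[\pi_0;\pi_1]\varphi$; $[\pi_0]\varphi$ or $[\pi_1]\varphi$ for $[\pi_0\cup\pi_1]\varphi$ at the left or right assumption; $\varphi$ or $[\pi][\pi^*]\varphi$ for $[\pi^*]\varphi$ at the left or right assumption); for any other rule, $\tau_{i+1}=\tau_i$. The index $i$ is a *progress point* if the rule at $i$ is (C-s), the path passes through its right assumption, $\tau_i$ is the principal formula $[\pi^*]\varphi$ and $\tau_{i+1}=[\pi][\pi^*]\varphi$. A *$\mathtt{CGPDL}$ proof* of $\Gamma\vdash\Delta$ is a pre-proof with root $\Gamma\vdash\Delta$ that satisfies the *global trace condition*: every infinite path in the derivation graph has a tail followed by a trace with infinitely many progress points. A proof is *cut-free* if no instance of (Cut) occurs in it. A sequent is *provable* (respectively *cut-free provable*) in $\mathtt{CGPDL}$ if it has a proof (respectively a cut-free proof). **Corollary (cut-elimination of $\mathtt{CGPDL}$).** If $\Gamma\vdash\Delta$ is provable in $\mathtt{CGPDL}$, then $\Gamma\vdash\Delta$ is cut-free provable in $\mathtt{CGPDL}$. -/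

import Mathlib

namespace PDL

/-- The two syntactic categories of well-formed expressions. -/
inductive Kind where
  | formula
  | program

/-- Well-formed expressions of propositional dynamic logic over a set `P` of propositional
variables and a set `A` of atomic programs. Formulas and programs are defined by simultaneous
induction, presented as one inductive family indexed by the syntactic category. -/
inductive Expr (P A : Type*) : Kind → Type _ where
  | bot : Expr P A .formula
  | var (p : P) : Expr P A .formula
  | imp (φ ψ : Expr P A .formula) : Expr P A .formula
  | box (π : Expr P A .program) (φ : Expr P A .formula) : Expr P A .formula
  | atom (a : A) : Expr P A .program
  | seq (π₀ π₁ : Expr P A .program) : Expr P A .program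
  | ndc (π₀ π₁ : Expr P A .program) : Expr P A .program
  | star (π : Expr P A .program) : Expr P A .program
  | test (φ : Expr P A .formula) : Expr P A .program

/-- Formulas: `⊥ | p | φ → ψ | [π]φ`. -/
abbrev Formula (P A : Type*) := Expr P A .formula

/-- Programs: `α | π₀ ; π₁ | π₀ ∪ π₁ | π* | φ?`. -/
abbrev Program (P A : Type*) := Expr P A .program

noncomputable instance instDecidableEqExpr (P A : Type*) (k : Kind) : DecidableEq (Expr P A k) :=
  Classical.decEq _

/-- A sequent is a pair of finite sets of formulas. -/
@[ext]
structure Sequent (P A : Type*) where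
  ant : Finset (Formula P A)
  suc : Finset (Formula P A)

end PDL

namespace CGPDL

open PDL PDL.Expr

/-- Instances of the inference rules of `CGPDL`. The arguments are the data of the instance;
its conclusion and its list of assumptions are given by `Rule.concl` and `Rule.prems`. -/
inductive Rule (P A : Type*) where
  | ax (Γ Δ : Finset (Formula P A)) (h : (Γ ∩ Δ).Nonempty)
  | botL (Γ Δ : Finset (Formula P A))
  | impL (Γ Δ : Finset (Formula P A)) (φ ψ : Formula P A)
  | impR (Γ Δ : Finset (Formula P A)) (φ ψ : Formula P A)
  | wk (Γ Δ Γ' Δ' : Finset (Formula P A)) (hΓ : Γ ⊆ Γ') (hΔ : Δ ⊆ Δ')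
  | cut (Γ Δ : Finset (Formula P A)) (φ : Formula P A)
  | boxK (Γ Γ' Δ : Finset (Formula P A)) (π : Program P A) (φ : Formula P A)
  | seqL (Γ Δ : Finset (Formula P A)) (π₀ π₁ : Program P A) (φ : Formula P A)
  | seqR (Γ Δ : Finset (Formula P A)) (π₀ π₁ : Program P A) (φ : Formula P A)
  | ndcL (Γ Δ : Finset (Formula P A)) (π₀ π₁ : Program P A) (φ : Formula P A)
  | ndcR (Γ Δ : Finset (Formula P A)) (π₀ π₁ : Program P A) (φ : Formula P A)
  | starL (Γ Δ : Finset (Formula P A)) (π : Program P A) (φ : Formula P A)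
  | caseSplit (Γ Δ : Finset (Formula P A)) (π : Program P A) (φ : Formula P A)
  | testL (Γ Δ : Finset (Formula P A)) (φ ψ : Formula P A)
  | testR (Γ Δ : Finset (Formula P A)) (φ ψ : Formula P A)

variable {P A : Type*}

/-- The conclusion of a rule instance. -/
noncomputable def Rule.concl : Rule P A → Sequent P A
  | .ax Γ Δ _ => ⟨Γ, Δ⟩
  | .botL Γ Δ => ⟨insert bot Γ, Δ⟩
  | .impL Γ Δ φ ψ => ⟨insert (imp φ ψ) Γ, Δ⟩
  | .impR Γ Δ φ ψ => ⟨Γ, insert (imp φ ψ) Δ⟩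
  | .wk _ _ Γ' Δ' _ _ => ⟨Γ', Δ'⟩
  | .cut Γ Δ _ => ⟨Γ, Δ⟩
  | .boxK Γ Γ' Δ π φ => ⟨Γ' ∪ Γ.image (box π), insert (box π φ) Δ⟩
  | .seqL Γ Δ π₀ π₁ φ => ⟨insert (box (seq π₀ π₁) φ) Γ, Δ⟩
  | .seqR Γ Δ π₀ π₁ φ => ⟨Γ, insert (box (seq π₀ π₁) φ) Δ⟩
  | .ndcL Γ Δ π₀ π₁ φ => ⟨insert (box (ndc π₀ π₁) φ) Γ, Δ⟩
  | .ndcR Γ Δ π₀ π₁ φ => ⟨Γ, insert (box (ndc π₀ π₁) φ) Δ⟩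
  | .starL Γ Δ π φ => ⟨insert (box (star π) φ) Γ, Δ⟩
  | .caseSplit Γ Δ π φ => ⟨Γ, insert (box (star π) φ) Δ⟩
  | .testL Γ Δ φ ψ => ⟨insert (box (test φ) ψ) Γ, Δ⟩
  | .testR Γ Δ φ ψ => ⟨Γ, insert (box (test φ) ψ) Δ⟩

/-- The list of assumptions of a rule instance, from left to right. -/
noncomputable def Rule.prems : Rule P A → List (Sequent P A)
  | .ax _ _ _ => []
  | .botL _ _ => []
  | .impL Γ Δ φ ψ => [⟨Γ, insert φ Δ⟩, ⟨insert ψ Γ, Δ⟩]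
  | .impR Γ Δ φ ψ => [⟨insert φ Γ, insert ψ Δ⟩]
  | .wk Γ Δ _ _ _ _ => [⟨Γ, Δ⟩]
  | .cut Γ Δ φ => [⟨Γ, insert φ Δ⟩, ⟨insert φ Γ, Δ⟩]
  | .boxK Γ _ _ _ φ => [⟨Γ, {φ}⟩]
  | .seqL Γ Δ π₀ π₁ φ => [⟨insert (box π₀ (box π₁ φ)) Γ, Δ⟩]
  | .seqR Γ Δ π₀ π₁ φ => [⟨Γ, insert (box π₀ (box π₁ φ)) Δ⟩]
  | .ndcL Γ Δ π₀ π₁ φ => [⟨insert (box π₀ φ) (insert (box π₁ φ) Γ), Δ⟩]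
  | .ndcR Γ Δ π₀ π₁ φ => [⟨Γ, insert (box π₀ φ) Δ⟩, ⟨Γ, insert (box π₁ φ) Δ⟩]
  | .starL Γ Δ π φ => [⟨insert φ (insert (box π (box (star π) φ)) Γ), Δ⟩]
  | .caseSplit Γ Δ π φ => [⟨Γ, insert φ Δ⟩, ⟨Γ, insert (box π (box (star π) φ)) Δ⟩]
  | .testL Γ Δ φ ψ => [⟨Γ, insert φ Δ⟩, ⟨insert ψ Γ, Δ⟩]
  | .testR Γ Δ φ ψ => [⟨insert φ Γ, insert ψ Δ⟩]

/-- A rule instance is an instance of the cut rule. -/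
def Rule.IsCut : Rule P A → Prop
  | .cut _ _ _ => True
  | _ => False

/-- `r.TraceStep j τ τ'`: a trace may go from the formula `τ` in the consequent of the conclusion
of `r` to the formula `τ'` in the consequent of the `j`-th assumption of `r` (counted from `0`).
That `τ` and `τ'` do lie in these consequents is required separately, in `PreProof.IsTrace`. -/
def Rule.TraceStep : Rule P A → ℕ → Formula P A → Formula P A → Prop
  | .impR _ _ φ ψ, _, τ, τ' => (τ = imp φ ψ ∧ τ' = ψ) ∨ τ' = τ
  | .boxK _ _ _ π φ, _, τ, τ' => τ = box π φ ∧ τ' = φ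
  | .seqR _ _ π₀ π₁ φ, _, τ, τ' =>
      (τ = box (seq π₀ π₁) φ ∧ τ' = box π₀ (box π₁ φ)) ∨ τ' = τ
  | .ndcR _ _ π₀ π₁ φ, j, τ, τ' =>
      (τ = box (ndc π₀ π₁) φ ∧ τ' = box (if j = 0 then π₀ else π₁) φ) ∨ τ' = τ
  | .testR _ _ φ ψ, _, τ, τ' => (τ = box (test φ) ψ ∧ τ' = ψ) ∨ τ' = τ
  | .caseSplit _ _ π φ, j, τ, τ' =>
      (τ = box (star π) φ ∧ τ' = if j = 0 then φ else box π (box (star π) φ)) ∨ τ' = τ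
  | _, _, τ, τ' => τ' = τ

/-- The step of a trace from `τ` to `τ'` at the `j`-th assumption of a rule instance is a progress
point: the rule is the case-split rule, the assumption is its right one, and the principal formula
`[π*]φ` is rewritten to `[π][π*]φ`. -/
def Rule.Progress : Rule P A → ℕ → Formula P A → Formula P A → Prop
  | .caseSplit _ _ π φ, j, τ, τ' =>
      j = 1 ∧ τ = box (star π) φ ∧ τ' = box π (box (star π) φ)
  | _, _, _, _ => False

/-- The label of a node of a derivation tree: either the node is a bud, carrying a sequent, or it
is the conclusion of a rule instance. -/
inductive Label (P A : Type*) where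
  | bud (S : Sequent P A)
  | rule (r : Rule P A)

/-- The sequent at a node. -/
noncomputable def Label.seq : Label P A → Sequent P A
  | .bud S => S
  | .rule r => r.concl

/-- A derivation tree: a finite tree of sequents in which every node is a bud or the conclusion of
a rule instance whose assumptions are the sequents at its children. Nodes are addresses: the root
is `[]`, and the child of `σ` at the `j`-th assumption is `j :: σ`. The values of `label` outside
`nodes` are irrelevant. -/
structure DerivTree (P A : Type*) where
  nodes : Finset (List ℕ)
  label : List ℕ → Label P A
  root_mem : [] ∈ nodes
  child_mem : ∀ (j : ℕ) (σ : List ℕ),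
    j :: σ ∈ nodes ↔ σ ∈ nodes ∧ ∃ r, label σ = .rule r ∧ j < r.prems.length
  child_seq : ∀ (σ : List ℕ) (r : Rule P A), σ ∈ nodes → label σ = .rule r →
    ∀ (j : ℕ) (hj : j < r.prems.length), (label (j :: σ)).seq = r.prems[j]

/-- A pre-proof: a derivation tree with a function sending each bud to a companion, that is, to an
inner node (the conclusion of a rule instance with at least one assumption) with the same
sequent. -/
structure PreProof (P A : Type*) extends DerivTree P A where
  companion : List ℕ → List ℕ
  companion_spec : ∀ (σ : List ℕ) (S : Sequent P A), σ ∈ nodes → label σ = .bud S →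
    companion σ ∈ nodes ∧ ∃ r, label (companion σ) = .rule r ∧ r.prems ≠ [] ∧ r.concl = S

/-- The node of the derivation graph represented by a node of the tree: buds are identified with
their companions. -/
def PreProof.toGraph (D : PreProof P A) (σ : List ℕ) : List ℕ :=
  match D.label σ with
  | .bud _ => D.companion σ
  | .rule _ => σ

/-- An infinite path in the derivation graph: the `i`-th node is `node i`, and the path leaves it
through its assumption number `dir i`. -/
def PreProof.IsPath (D : PreProof P A) (node : ℕ → List ℕ) (dir : ℕ → ℕ) : Prop :=
  ∀ i, node i ∈ D.nodes ∧
    ∃ r, D.label (node i) = .rule r ∧ dir i < r.prems.length ∧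
      node (i + 1) = D.toGraph (dir i :: node i)

/-- `τ` is a trace following the tail from index `k` on of the path `(node, dir)`; the values `τ i`
with `i < k` are irrelevant. -/
def PreProof.IsTrace (D : PreProof P A) (node : ℕ → List ℕ) (dir : ℕ → ℕ) (k : ℕ)
    (τ : ℕ → Formula P A) : Prop :=
  ∀ i, k ≤ i → τ i ∈ (D.label (node i)).seq.suc ∧
    ∀ r, D.label (node i) = .rule r → r.TraceStep (dir i) (τ i) (τ (i + 1))

/-- `i` is a progress point of the trace `τ`. -/
def PreProof.IsProgressPoint (D : PreProof P A) (node : ℕ → List ℕ) (dir : ℕ → ℕ)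
    (τ : ℕ → Formula P A) (i : ℕ) : Prop :=
  ∃ r, D.label (node i) = .rule r ∧ r.Progress (dir i) (τ i) (τ (i + 1))

/-- The global trace condition: every infinite path of the derivation graph has a tail that is
followed by a trace with infinitely many progress points. -/
def PreProof.GlobalTrace (D : PreProof P A) : Prop :=
  ∀ (node : ℕ → List ℕ) (dir : ℕ → ℕ), D.IsPath node dir →
    ∃ (k : ℕ) (τ : ℕ → Formula P A), D.IsTrace node dir k τ ∧
      ∀ n, ∃ i, n ≤ i ∧ k ≤ i ∧ D.IsProgressPoint node dir τ i

/-- `D` is a `CGPDL` proof of the sequent `S`. -/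
def PreProof.IsProofOf (D : PreProof P A) (S : Sequent P A) : Prop :=
  (D.label []).seq = S ∧ D.GlobalTrace

/-- No instance of the cut rule occurs in the pre-proof. -/
def PreProof.CutFree (D : PreProof P A) : Prop :=
  ∀ σ ∈ D.nodes, ∀ r, D.label σ = .rule r → ¬ r.IsCut

/-- The sequent `S` is provable in `CGPDL`. -/
def Provable (S : Sequent P A) : Prop :=
  ∃ D : PreProof P A, D.IsProofOf S

/-- The sequent `S` is cut-free provable in `CGPDL`. -/
def CutFreeProvable (S : Sequent P A) : Prop :=
  ∃ D : PreProof P A, D.IsProofOf S ∧ D.CutFree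

end CGPDL

/-! Cut is eliminated semantically: proofs with cuts are sound for Kripke models, and a sequent
without a cut-free proof is refuted in a canonical model.

Soundness (`Kripke.not_refutes_of_provable`): the cost of refuting a formula is the least number of
star iterations that a refutation uses. A refuted root yields an infinite path of refuted sequents
on which the cost never increases along a trace and drops at each progress point. This contradicts
the global trace condition.

Completeness (`graphProvable_of_provable`): fix a finite set `C` closed in the sense of Fischer and
Ladner. States are unprovable saturated sequents over `C`; `exists_state` extends every unprovable
sequent over `C` to one, and `truthSpec` shows that a state makes its antecedent true and its
consequent false. The crux is that a false-side formula `[π]χ` really has a refuting run. If it had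
none, proof search following `[π]χ` would close up into a cyclic cut-free proof
(`graphProvable_of_true`), where infinite branches are good because `[π]χ` or an auxiliary formula
is unfolded through stars infinitely often (`FocusSystem.graphProvable`).

Cyclic proofs are handled as finite graphs of rule instances, and are unfolded into trees with buds
only at the end (`GraphProvable.cutFreeProvable`). -/

namespace CGPDL

open PDL PDL.Expr

universe u v w

/-! ### Finite proof graphs and the global trace condition -/

section Graphs

variable {P : Type u} {A : Type v}

/-- An infinite sequence of rule instances, left through the assumptions `d`, has a tail followed
by a trace with infinitely many progress points. -/
def HasProgressingTrace (r : ℕ → Rule P A) (d : ℕ → ℕ) : Prop :=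
  ∃ (k : ℕ) (τ : ℕ → Formula P A),
    (∀ i, k ≤ i → τ i ∈ (r i).concl.suc ∧ (r i).TraceStep (d i) (τ i) (τ (i + 1))) ∧
    ∀ n, ∃ i, n ≤ i ∧ k ≤ i ∧ (r i).Progress (d i) (τ i) (τ (i + 1))

theorem HasProgressingTrace.of_tail {r : ℕ → Rule P A} {d : ℕ → ℕ} (n : ℕ)
    (h : HasProgressingTrace (fun i => r (n + i)) (fun i => d (n + i))) :
    HasProgressingTrace r d := by
  obtain ⟨k, τ, h1, h2⟩ := h
  -- Truncation of `i - n` is harmless: only indices `i ≥ n + k` count.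
  refine ⟨n + k, fun i => τ (i - n), ?_, ?_⟩
  · intro i hi
    obtain ⟨j, rfl⟩ := Nat.exists_eq_add_of_le (show n ≤ i by omega)
    have := h1 j (by omega)
    simpa [show n + j + 1 - n = j + 1 by omega] using this
  · intro m
    obtain ⟨i, hi1, hi2, hi3⟩ := h2 m
    refine ⟨n + i, by omega, by omega, ?_⟩
    simpa [show n + i + 1 - n = i + 1 by omega] using hi3

/-- A finite graph of cut-free rule instances all of whose infinite paths have a progressing
trace. -/
structure ProofGraph (P : Type u) (A : Type v) where
  V : Type (max u v)
  finite : Finite V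
  rule : V → Rule P A
  next : V → ℕ → V
  next_concl : ∀ (v : V) (j : ℕ) (hj : j < (rule v).prems.length),
    (rule (next v j)).concl = (rule v).prems[j]
  cutFree : ∀ v, ¬ (rule v).IsCut
  good : ∀ (v : ℕ → V) (d : ℕ → ℕ),
    (∀ i, d i < (rule (v i)).prems.length ∧ v (i + 1) = next (v i) (d i)) →
    HasProgressingTrace (fun i => rule (v i)) d

/-- The sequent is the conclusion of a vertex of a proof graph. -/
def GraphProvable (S : Sequent P A) : Prop :=
  ∃ (G : ProofGraph P A) (v : G.V), (G.rule v).concl = S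

/-! ### Unfolding a proof graph into a pre-proof -/

namespace ProofGraph

variable (G : ProofGraph P A) (v₀ : G.V)

/-- The vertex at an address of the unfolding of the graph. -/
def vertexAt : List ℕ → G.V
  | [] => v₀
  | j :: σ => G.next (vertexAt σ) j

/-- The vertices at the proper ancestors of an address. -/
def ancestors : List ℕ → List G.V
  | [] => []
  | _ :: σ => G.vertexAt v₀ σ :: ancestors σ

/-- The addresses of the unfolding that is cut off at repeated vertices. -/
def IsNode : List ℕ → Prop
  | [] => True
  | j :: σ => IsNode σ ∧ G.vertexAt v₀ σ ∉ G.ancestors v₀ σ ∧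
      j < (G.rule (G.vertexAt v₀ σ)).prems.length

theorem _root_.CGPDL.Rule.prems_length_le (r : Rule P A) : r.prems.length ≤ 2 := by
  cases r <;> simp [Rule.prems]

theorem ancestors_length (σ : List ℕ) : (G.ancestors v₀ σ).length = σ.length := by
  induction σ with
  | nil => rfl
  | cons j σ ih => simp [ancestors, ih]

theorem IsNode.nodup {σ : List ℕ} (h : G.IsNode v₀ σ) : (G.ancestors v₀ σ).Nodup := by
  induction σ with
  | nil => exact List.nodup_nil
  | cons j σ ih => exact List.nodup_cons.2 ⟨h.2.1, ih h.1⟩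

/-- The companion is the proper ancestor at which `v` occurs. It is not itself a bud because the
unfolding continued below it, which also shows that its rule has an assumption. -/
theorem IsNode.exists_companion {σ : List ℕ} (h : G.IsNode v₀ σ) {v : G.V}
    (hv : v ∈ G.ancestors v₀ σ) :
    ∃ ρ, G.IsNode v₀ ρ ∧ G.vertexAt v₀ ρ ∉ G.ancestors v₀ ρ ∧ G.vertexAt v₀ ρ = v ∧
      (G.rule v).prems ≠ [] := by
  induction σ with
  | nil => simp [ancestors] at hv
  | cons j σ ih =>
    rcases List.mem_cons.1 hv with rfl | hv
    · refine ⟨σ, h.1, h.2.1, rfl, fun h0 => ?_⟩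
      have := h.2.2
      simp [h0] at this
    · exact ih h.1 hv

/-- Branching is at most binary, and the depth is at most the number of vertices because the
vertices at proper ancestors of a node are distinct. -/
theorem finite_isNode : {σ | G.IsNode v₀ σ}.Finite := by
  have := G.finite
  have := Fintype.ofFinite G.V
  have level : ∀ n, {σ | G.IsNode v₀ σ ∧ σ.length = n}.Finite := by
    intro n
    induction n with
    | zero =>
      refine (Set.finite_singleton []).subset ?_
      rintro σ ⟨-, h⟩
      exact List.length_eq_zero_iff.1 h
    | succ n ih =>
      refine ((Set.finite_Iio 2).image2 List.cons ih).subset ?_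
      rintro (_ | ⟨j, σ⟩) ⟨h, hl⟩
      · simp at hl
      · exact ⟨j, lt_of_lt_of_le h.2.2 (Rule.prems_length_le _), σ, ⟨h.1, by simpa using hl⟩, rfl⟩
  refine ((Set.finite_Iic (Fintype.card G.V)).biUnion fun n _ => level n).subset ?_
  intro σ h
  simp only [Set.mem_iUnion]
  refine ⟨σ.length, ?_, h, rfl⟩
  rw [Set.mem_Iic, ← G.ancestors_length v₀]
  exact (IsNode.nodup G v₀ h).length_le_card

open Classical in
/-- The unfolding of a proof graph, cut off at repeated vertices. -/
noncomputable def unfold : PreProof P A where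
  nodes := (G.finite_isNode v₀).toFinset
  label σ := if G.vertexAt v₀ σ ∈ G.ancestors v₀ σ
    then .bud (G.rule (G.vertexAt v₀ σ)).concl else .rule (G.rule (G.vertexAt v₀ σ))
  companion σ := if h : G.IsNode v₀ σ ∧ G.vertexAt v₀ σ ∈ G.ancestors v₀ σ
    then (IsNode.exists_companion G v₀ h.1 h.2).choose else σ
  root_mem := by simp [IsNode]
  child_mem j σ := by
    simp only [Set.Finite.mem_toFinset, Set.mem_ofPred_eq, IsNode]
    constructor
    · rintro ⟨h1, h2, h3⟩
      exact ⟨h1, _, if_neg h2, h3⟩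
    · rintro ⟨h1, r, h2, h3⟩
      split_ifs at h2 with h
      cases h2
      exact ⟨h1, h, h3⟩
  child_seq σ r hσ hr j hj := by
    split_ifs at hr with h
    cases hr
    rw [← G.next_concl _ _ hj]
    split_ifs <;> rfl
  companion_spec σ S hσ hS := by
    split_ifs at hS with h
    cases hS
    have hn : G.IsNode v₀ σ := by simpa using hσ
    rw [dif_pos ⟨hn, h⟩]
    obtain ⟨h1, h2, h3, h4⟩ := (IsNode.exists_companion G v₀ hn h).choose_spec
    refine ⟨by simpa using h1, _, if_neg h2, ?_, ?_⟩ <;> rw [h3]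
    exact h4

theorem rule_of_unfold_label {σ : List ℕ} {r : Rule P A}
    (h : (G.unfold v₀).label σ = .rule r) : r = G.rule (G.vertexAt v₀ σ) := by
  simp only [unfold] at h
  split_ifs at h with h0
  cases h
  rfl

theorem unfold_seq (σ : List ℕ) :
    ((G.unfold v₀).label σ).seq = (G.rule (G.vertexAt v₀ σ)).concl := by
  simp only [unfold]
  split_ifs <;> rfl

theorem vertexAt_toGraph {σ : List ℕ} (h : σ ∈ (G.unfold v₀).nodes) :
    G.vertexAt v₀ ((G.unfold v₀).toGraph σ) = G.vertexAt v₀ σ := by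
  have hn : G.IsNode v₀ σ := by simpa [unfold] using h
  by_cases h0 : G.vertexAt v₀ σ ∈ G.ancestors v₀ σ
  · have hl : (G.unfold v₀).label σ = .bud (G.rule (G.vertexAt v₀ σ)).concl := by
      simp [unfold, h0]
    simp only [PreProof.toGraph, hl]
    simp only [unfold, dif_pos (show _ ∧ _ from ⟨hn, h0⟩)]
    exact (IsNode.exists_companion G v₀ hn h0).choose_spec.2.2.1
  · have hl : (G.unfold v₀).label σ = .rule (G.rule (G.vertexAt v₀ σ)) := by
      simp [unfold, h0]
    simp only [PreProof.toGraph, hl]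

/-- Jumping from a bud to its companion does not change the vertex, so a path of the derivation
graph projects to a path of `G`, whose trace can be used unchanged. -/
theorem globalTrace_unfold : (G.unfold v₀).GlobalTrace := by
  intro node dir hp
  choose hnode r hr hdir hnext using hp
  have hr' : ∀ i, r i = G.rule (G.vertexAt v₀ (node i)) :=
    fun i => G.rule_of_unfold_label v₀ (hr i)
  obtain ⟨k, τ, h1, h2⟩ := G.good (fun i => G.vertexAt v₀ (node i)) dir fun i => by
    refine ⟨hr' i ▸ hdir i, ?_⟩
    rw [hnext i, G.vertexAt_toGraph v₀]
    · rfl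
    · exact ((G.unfold v₀).child_mem _ _).2 ⟨hnode i, r i, hr i, hdir i⟩
  refine ⟨k, τ, fun i hi => ⟨?_, fun r' h' => ?_⟩, fun n => ?_⟩
  · rw [unfold_seq]
    exact (h1 i hi).1
  · rw [G.rule_of_unfold_label v₀ h']
    exact (h1 i hi).2
  · obtain ⟨i, hi, hk, hpr⟩ := h2 n
    exact ⟨i, hi, hk, r i, hr i, by rw [hr']; exact hpr⟩

end ProofGraph

theorem GraphProvable.cutFreeProvable {S : Sequent P A} (h : GraphProvable S) :
    CutFreeProvable S := by
  obtain ⟨G, v, rfl⟩ := h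
  refine ⟨G.unfold v, ⟨G.unfold_seq v [], G.globalTrace_unfold v⟩, fun σ _ r hr => ?_⟩
  rw [G.rule_of_unfold_label v hr]
  exact G.cutFree _

/-! ### Building proof graphs from focused sequents -/

theorem exists_eventually_const {f : ℕ → ℕ} {N : ℕ} (h : ∀ i, N ≤ i → f (i + 1) ≤ f i) :
    ∃ M, N ≤ M ∧ ∀ i, M ≤ i → f (i + 1) = f i := by
  obtain ⟨M, hM, hmin⟩ : ∃ M, N ≤ M ∧ ∀ i, N ≤ i → f M ≤ f i := by
    have hne : (f '' Set.Ici N).Nonempty := ⟨f N, N, le_refl N, rfl⟩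
    obtain ⟨M, hM, hM'⟩ := Nat.sInf_mem hne
    exact ⟨M, hM, fun i hi => hM' ▸ Nat.sInf_le ⟨i, hi, rfl⟩⟩
  have hle : ∀ i, M ≤ i → f i ≤ f M := by
    intro i hi
    induction i, hi using Nat.le_induction with
    | base => exact le_rfl
    | succ i hi ih => exact (h i (hM.trans hi)).trans ih
  refine ⟨M, hM, fun i hi => ?_⟩
  have h1 := hle i hi
  have h2 := hle (i + 1) (by omega)
  have h3 := hmin i (by omega)
  have h4 := hmin (i + 1) (by omega)
  omega

theorem not_eventually_decreasing {f : ℕ → ℕ} {N : ℕ} (h : ∀ i, N ≤ i → f (i + 1) < f i) :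
    False := by
  obtain ⟨M, hM, h'⟩ := exists_eventually_const fun i hi => (h i hi).le
  exact (h M hM).ne (h' M le_rfl)

/-- The data of a system of focused sequents: every vertex carries a sequent, a main and a
secondary focus, and a rank for each. -/
structure FocusSystem (P : Type u) (A : Type v) (V : Type (max u v)) where
  seq : V → Sequent P A
  focus : V → Formula P A
  focus' : V → Formula P A
  rank : V → ℕ
  rank' : V → ℕ

/-- A permitted step from the vertex `w` to the vertex `w'` at the `j`-th assumption of `r`: the
main focus follows a trace; if it makes no progress, its rank does not increase, and if moreover
this rank stays the same, then the secondary focus follows a trace and progresses or decreases its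
rank. -/
def FocusSystem.Step {V : Type (max u v)} (F : FocusSystem P A V) (r : Rule P A) (j : ℕ)
    (w w' : V) : Prop :=
  F.focus w ∈ (F.seq w).suc ∧ r.TraceStep j (F.focus w) (F.focus w') ∧
  (r.Progress j (F.focus w) (F.focus w') ∨ F.rank w' < F.rank w ∨
    F.rank w' = F.rank w ∧ F.focus' w ∈ (F.seq w).suc ∧
      r.TraceStep j (F.focus' w) (F.focus' w') ∧
      (r.Progress j (F.focus' w) (F.focus' w') ∨ F.rank' w' < F.rank' w))

/-- If the main focus progresses infinitely often, it is the required trace. Otherwise its rank is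
eventually non-increasing, hence eventually constant. From then on the secondary focus is a trace,
and it progresses infinitely often because its rank cannot decrease forever. -/
theorem FocusSystem.hasProgressingTrace {V : Type (max u v)} (F : FocusSystem P A V)
    (r : ℕ → Rule P A) (d : ℕ → ℕ) (w : ℕ → V) (hr : ∀ i, (r i).concl = F.seq (w i))
    (hs : ∀ i, F.Step (r i) (d i) (w i) (w (i + 1))) : HasProgressingTrace r d := by
  by_cases hA : ∀ n, ∃ i, n ≤ i ∧ (r i).Progress (d i) (F.focus (w i)) (F.focus (w (i + 1)))
  · refine ⟨0, fun i => F.focus (w i), fun i _ => ⟨?_, (hs i).2.1⟩, fun n => ?_⟩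
    · rw [hr]
      exact (hs i).1
    · obtain ⟨i, hi, hp⟩ := hA n
      exact ⟨i, hi, Nat.zero_le _, hp⟩
  · push Not at hA
    obtain ⟨N, hN⟩ := hA
    have hs' := fun i hi => (hs i).2.2.resolve_left (hN i hi)
    obtain ⟨M, hM, hconst⟩ := exists_eventually_const (f := fun i => F.rank (w i)) (N := N)
      fun i hi => (hs' i hi).elim le_of_lt fun h => h.1.le
    have hs2 := fun i (hi : M ≤ i) => (hs' i (hM.trans hi)).resolve_left (hconst i hi).not_lt
    refine ⟨M, fun i => F.focus' (w i), fun i hi => ⟨?_, (hs2 i hi).2.2.1⟩, fun n => ?_⟩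
    · rw [hr]
      exact (hs2 i hi).2.1
    · by_contra! hno
      refine not_eventually_decreasing (f := fun i => F.rank' (w i)) (N := max n M)
        fun i hi => ?_
      exact (hs2 i (by omega)).2.2.2.resolve_left (hno i (by omega) (by omega))

/-- A finite system of focused sequents, each concluded by a cut-free rule instance all of whose
assumptions are provable or reached by a permitted step, consists of provable sequents. -/
theorem FocusSystem.graphProvable {V : Type (max u v)} [Finite V] (F : FocusSystem P A V)
    (h : ∀ w, ∃ r : Rule P A, ¬ r.IsCut ∧ r.concl = F.seq w ∧
      ∀ (j : ℕ) (hj : j < r.prems.length), GraphProvable r.prems[j] ∨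
        ∃ w', F.seq w' = r.prems[j] ∧ F.Step r j w w') (w : V) :
    GraphProvable (F.seq w) := by
  classical
  choose r hcut hconcl hprem using h
  -- The proof graph consists of the system itself with a separate proof graph attached at each
  -- provable assumption.
  let I := {p : Σ w, Fin (r w).prems.length // GraphProvable (r p.1).prems[p.2]}
  have hI : ∀ i : I, GraphProvable (r i.1.1).prems[i.1.2] := fun i => i.2
  choose G root hroot using hI
  have := fun i => (G i).finite
  have key : ∀ w j, ∃ x : V ⊕ (Σ i : I, (G i).V), ∀ hj : j < (r w).prems.length,
      (∃ i, x = Sum.inr ⟨i, root i⟩ ∧ (r i.1.1).prems[i.1.2] = (r w).prems[j]) ∨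
      (∃ w', x = Sum.inl w' ∧ F.seq w' = (r w).prems[j] ∧ F.Step (r w) j w w') := by
    intro w j
    by_cases hj : j < (r w).prems.length
    · rcases hprem w j hj with h | ⟨w', h⟩
      · exact ⟨Sum.inr ⟨⟨⟨w, ⟨j, hj⟩⟩, h⟩, root _⟩, fun _ => Or.inl ⟨_, rfl, rfl⟩⟩
      · exact ⟨Sum.inl w', fun _ => Or.inr ⟨w', rfl, h⟩⟩
    · exact ⟨Sum.inl w, fun h => absurd h hj⟩
  choose nxt hnxt using key
  let rule : V ⊕ (Σ i : I, (G i).V) → Rule P A :=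
    Sum.elim r fun x => (G x.1).rule x.2
  let next : V ⊕ (Σ i : I, (G i).V) → ℕ → V ⊕ (Σ i : I, (G i).V) := fun x j =>
    Sum.elim (fun w => nxt w j) (fun x => Sum.inr ⟨x.1, (G x.1).next x.2 j⟩) x
  refine ⟨⟨V ⊕ (Σ i : I, (G i).V), inferInstance, rule, next, ?_, ?_, ?_⟩, Sum.inl w, hconcl w⟩
  · rintro (w | ⟨i, x⟩) j hj
    · rcases hnxt w j hj with ⟨i, h1, h2⟩ | ⟨w', h1, h2, -⟩
      · change (rule (nxt w j)).concl = _
        rw [h1]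
        exact (hroot i).trans h2
      · change (rule (nxt w j)).concl = _
        rw [h1]
        exact (hconcl w').trans h2
    · exact (G i).next_concl x j hj
  · rintro (w | ⟨i, x⟩)
    · exact hcut w
    · exact (G i).cutFree x
  · intro v d hp
    -- A path that enters an attached graph never leaves it and inherits its trace; any other path
    -- stays in the focus system.
    by_cases hv : ∃ n i x, v n = Sum.inr ⟨i, x⟩
    · obtain ⟨n, i, x, hx⟩ := hv
      let y : ℕ → (G i).V := fun k => Nat.rec x (fun k z => (G i).next z (d (n + k))) k
      have hy : ∀ k, v (n + k) = Sum.inr ⟨i, y k⟩ := by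
        intro k
        induction k with
        | zero => exact hx
        | succ k ih =>
          rw [← add_assoc, (hp (n + k)).2, ih]
          rfl
      refine HasProgressingTrace.of_tail n ?_
      have hg := (G i).good y (fun k => d (n + k)) fun k => by
        refine ⟨?_, rfl⟩
        have := (hp (n + k)).1
        rw [hy k] at this
        exact this
      convert hg using 2 with k
      rw [hy k]
      rfl
    · have hw : ∀ n, ∃ w, v n = Sum.inl w := by
        intro n
        cases hn : v n with
        | inl w => exact ⟨w, rfl⟩
        | inr x => exact absurd ⟨n, x.1, x.2, hn⟩ hv
      choose w hw using hw
      refine F.hasProgressingTrace _ d w (fun i => ?_) fun i => ?_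
      · rw [hw i]
        exact hconcl (w i)
      · have h1 := (hp i).1
        have h2 := (hp i).2
        rw [hw i] at h1 h2
        rw [hw (i + 1)] at h2
        rw [hw i]
        rcases hnxt (w i) (d i) h1 with ⟨j, h3, -⟩ | ⟨w', h3, -, h4⟩
        · exact absurd (h2.trans h3) (by simp)
        · rw [Sum.inl.inj (h2.trans h3)]
          exact h4

/-- A focus system with one vertex and no internal steps; its foci and ranks are placeholders. -/
theorem GraphProvable.of_rule {r : Rule P A} (hcut : ¬ r.IsCut)
    (h : ∀ (j : ℕ) (hj : j < r.prems.length), GraphProvable r.prems[j]) :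
    GraphProvable r.concl :=
  FocusSystem.graphProvable (V := PUnit)
    ⟨fun _ => r.concl, fun _ => bot, fun _ => bot, fun _ => 0, fun _ => 0⟩
    (fun _ => ⟨r, hcut, rfl, fun j hj => Or.inl (h j hj)⟩) PUnit.unit

end Graphs

/-! ### Soundness via the cost of refutations -/

section Soundness

variable {P : Type u} {A : Type v} {W : Type w}

/-- Kripke models. -/
structure Kripke (P : Type u) (A : Type v) (W : Type w) where
  trans : A → W → W → Prop
  val : P → W → Prop

/-- Finite iterations of a weighted relation, where every iteration costs one more. -/
inductive StarRun (R : W → W → ℕ → Prop) : W → W → ℕ → Prop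
  | refl (s : W) : StarRun R s s 0
  | step {s u t : W} {a b : ℕ} : R s u a → StarRun R u t b → StarRun R s t (a + b + 1)

/-- The type of meanings of expressions: a formula is read as a relation between a state that
refutes it and the cost of a refutation, a program as a weighted transition relation. -/
abbrev Meaning (W : Type w) : Kind → Type w
  | .formula => W → ℕ → Prop
  | .program => W → W → ℕ → Prop

/-- The refutations and runs of expressions in a Kripke model, weighted by the number of star
iterations they use. -/
def Kripke.eval (M : Kripke P A W) : {k : Kind} → Expr P A k → Meaning W k
  | _, .bot => fun _ n => n = 0
  | _, .var p => fun s n => ¬ M.val p s ∧ n = 0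
  | _, .imp φ ψ => fun s n => (∀ m, ¬ M.eval φ s m) ∧ M.eval ψ s n
  | _, .box π φ => fun s n => ∃ t a b, M.eval π s t a ∧ M.eval φ t b ∧ n = a + b
  | _, .atom α => fun s t n => M.trans α s t ∧ n = 0
  | _, .seq π₀ π₁ => fun s t n => ∃ x a b, M.eval π₀ s x a ∧ M.eval π₁ x t b ∧ n = a + b
  | _, .ndc π₀ π₁ => fun s t n => M.eval π₀ s t n ∨ M.eval π₁ s t n
  | _, .star π => StarRun (M.eval π)
  | _, .test φ => fun s t n => s = t ∧ n = 0 ∧ ∀ m, ¬ M.eval φ s m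

namespace Kripke

variable (M : Kripke P A W)

/-- Truth of a formula at a state: there is no refutation. -/
def True (φ : Formula P A) (s : W) : Prop := ∀ n, ¬ M.eval φ s n

/-- The least cost of a refutation. -/
noncomputable def cost (φ : Formula P A) (s : W) : ℕ := sInf {n | M.eval φ s n}

theorem eval_cost {φ : Formula P A} {s : W} (h : ¬ M.True φ s) : M.eval φ s (M.cost φ s) := by
  simp only [True, not_forall, not_not] at h
  exact Nat.sInf_mem h

theorem cost_le {φ : Formula P A} {s : W} {n : ℕ} (h : M.eval φ s n) : M.cost φ s ≤ n :=
  Nat.sInf_le h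

theorem not_true_of_eval {φ : Formula P A} {s : W} {n : ℕ} (h : M.eval φ s n) : ¬ M.True φ s :=
  fun h' => h' n h

theorem true_imp {φ ψ : Formula P A} {s : W} :
    M.True (imp φ ψ) s ↔ (M.True φ s → M.True ψ s) :=
  ⟨fun h h1 n h2 => h n ⟨h1, h2⟩, fun h n h1 => h h1.1 n h1.2⟩

theorem true_box {π : Program P A} {φ : Formula P A} {s : W} :
    M.True (box π φ) s ↔ ∀ t n, M.eval π s t n → M.True φ t :=
  ⟨fun h t n h1 m h2 => h (n + m) ⟨t, n, m, h1, h2, rfl⟩,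
    fun h _ ⟨t, a, b, h1, h2, _⟩ => h t a h1 b h2⟩

theorem true_box_seq {π₀ π₁ : Program P A} {φ : Formula P A} {s : W} :
    M.True (box (seq π₀ π₁) φ) s ↔ M.True (box π₀ (box π₁ φ)) s := by
  simp only [true_box]
  constructor
  · intro h t n h1 x m h2
    exact h x (n + m) ⟨t, n, m, h1, h2, rfl⟩
  · rintro h t n ⟨x, a, b, h1, h2, -⟩
    exact h x a h1 t b h2

theorem true_box_ndc {π₀ π₁ : Program P A} {φ : Formula P A} {s : W} :
    M.True (box (ndc π₀ π₁) φ) s ↔ M.True (box π₀ φ) s ∧ M.True (box π₁ φ) s := by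
  simp only [true_box]
  exact ⟨fun h => ⟨fun t n h1 => h t n (Or.inl h1), fun t n h1 => h t n (Or.inr h1)⟩,
    fun h t n h1 => h1.elim (h.1 t n) (h.2 t n)⟩

theorem true_box_star {π : Program P A} {φ : Formula P A} {s : W} :
    M.True (box (star π) φ) s ↔ M.True φ s ∧ M.True (box π (box (star π) φ)) s := by
  simp only [true_box]
  constructor
  · intro h
    exact ⟨h s 0 (.refl s), fun t n h1 x m h2 => h x (n + m + 1) (.step h1 h2)⟩
  · rintro ⟨h1, h2⟩ t n h
    cases h with
    | refl => exact h1
    | step h3 h4 => exact h2 _ _ h3 _ _ h4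

theorem true_box_test {φ ψ : Formula P A} {s : W} :
    M.True (box (test φ) ψ) s ↔ (M.True φ s → M.True ψ s) := by
  simp only [true_box]
  constructor
  · intro h h1
    exact h s 0 ⟨rfl, rfl, h1⟩
  · rintro h t n ⟨rfl, -, h1⟩
    exact h h1

/-- The state refutes the sequent. -/
def Refutes (s : W) (S : Sequent P A) : Prop :=
  (∀ φ ∈ S.ant, M.True φ s) ∧ ∀ φ ∈ S.suc, ¬ M.True φ s

/-- A refutation of the conclusion of a rule instance yields a refutation of one of its
assumptions along which traces do not increase the cost, and decrease it at progress points. -/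
theorem exists_refutes_prem (r : Rule P A) (s : W) (h : M.Refutes s r.concl) :
    ∃ (j : ℕ) (hj : j < r.prems.length) (t : W), M.Refutes t r.prems[j] ∧
      ∀ τ τ', ¬ M.True τ s → r.TraceStep j τ τ' →
        M.cost τ' t ≤ M.cost τ s ∧ (r.Progress j τ τ' → M.cost τ' t < M.cost τ s) := by
  obtain ⟨hL, hR⟩ := h
  cases r with
  | ax Γ Δ h =>
    obtain ⟨φ, hφ⟩ := h
    rw [Finset.mem_inter] at hφ
    exact absurd (hL φ hφ.1) (hR φ hφ.2)
  | botL Γ Δ => exact absurd rfl (hL bot (Finset.mem_insert_self _ _) 0)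
  | impL Γ Δ φ ψ =>
    simp only [Rule.concl, Finset.forall_mem_insert] at hL hR
    by_cases hφ : M.True φ s
    · refine ⟨1, by simp [Rule.prems], s, ⟨?_, hR⟩, ?_⟩
      · simpa [Rule.prems] using ⟨(M.true_imp.1 hL.1) hφ, hL.2⟩
      · rintro τ _ - rfl
        exact ⟨le_rfl, False.elim⟩
    · refine ⟨0, by simp [Rule.prems], s, ⟨hL.2, ?_⟩, ?_⟩
      · simpa [Rule.prems] using ⟨hφ, hR⟩
      · rintro τ _ - rfl
        exact ⟨le_rfl, False.elim⟩
  | impR Γ Δ φ ψ =>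
    simp only [Rule.concl, Finset.forall_mem_insert] at hL hR
    have h1 := hR.1
    rw [true_imp, Classical.not_imp] at h1
    refine ⟨0, by simp [Rule.prems], s, ⟨?_, ?_⟩, ?_⟩
    · simpa [Rule.prems] using ⟨h1.1, hL⟩
    · simpa [Rule.prems] using ⟨h1.2, hR.2⟩
    · rintro τ τ' hτ (⟨rfl, rfl⟩ | rfl)
      · exact ⟨M.cost_le (M.eval_cost hτ).2, False.elim⟩
      · exact ⟨le_rfl, False.elim⟩
  | wk Γ Δ Γ' Δ' hΓ hΔ =>
    refine ⟨0, by simp [Rule.prems], s, ⟨fun φ h => hL φ (hΓ h), fun φ h => hR φ (hΔ h)⟩, ?_⟩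
    rintro τ _ - rfl
    exact ⟨le_rfl, False.elim⟩
  | cut Γ Δ φ =>
    simp only [Rule.concl] at hL hR
    by_cases hφ : M.True φ s
    · refine ⟨1, by simp [Rule.prems], s, ⟨?_, hR⟩, ?_⟩
      · simpa [Rule.prems] using ⟨hφ, hL⟩
      · rintro τ _ - rfl
        exact ⟨le_rfl, False.elim⟩
    · refine ⟨0, by simp [Rule.prems], s, ⟨hL, ?_⟩, ?_⟩
      · simpa [Rule.prems] using ⟨hφ, hR⟩
      · rintro τ _ - rfl
        exact ⟨le_rfl, False.elim⟩
  | boxK Γ Γ' Δ π φ =>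
    simp only [Rule.concl, Finset.forall_mem_insert] at hL hR
    -- The state moves to the end of the run in a cheapest refutation of `[π]φ`.
    obtain ⟨t, a, b, h1, h2, h3⟩ := M.eval_cost hR.1
    refine ⟨0, by simp [Rule.prems], t, ⟨?_, ?_⟩, ?_⟩
    · intro ψ hψ
      exact M.true_box.1 (hL (box π ψ) (Finset.mem_union_right _ (Finset.mem_image_of_mem _ hψ)))
        t a h1
    · simpa [Rule.prems] using M.not_true_of_eval h2
    · rintro τ τ' - ⟨rfl, rfl⟩
      exact ⟨(M.cost_le h2).trans (by omega), False.elim⟩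
  | seqL Γ Δ π₀ π₁ φ =>
    simp only [Rule.concl, Finset.forall_mem_insert] at hL hR
    refine ⟨0, by simp [Rule.prems], s, ⟨?_, hR⟩, ?_⟩
    · simpa [Rule.prems] using ⟨M.true_box_seq.1 hL.1, hL.2⟩
    · rintro τ _ - rfl
      exact ⟨le_rfl, False.elim⟩
  | seqR Γ Δ π₀ π₁ φ =>
    simp only [Rule.concl, Finset.forall_mem_insert] at hL hR
    refine ⟨0, by simp [Rule.prems], s, ⟨hL, ?_⟩, ?_⟩
    · simpa [Rule.prems] using ⟨fun h => hR.1 (M.true_box_seq.2 h), hR.2⟩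
    · rintro τ τ' hτ (⟨rfl, rfl⟩ | rfl)
      · obtain ⟨t, _, b, ⟨x, a, a', h1, h2, rfl⟩, h3, h4⟩ := M.eval_cost hτ
        refine ⟨M.cost_le ?_, False.elim⟩
        rw [h4, add_assoc]
        exact ⟨x, a, a' + b, h1, ⟨t, a', b, h2, h3, rfl⟩, rfl⟩
      · exact ⟨le_rfl, False.elim⟩
  | ndcL Γ Δ π₀ π₁ φ =>
    simp only [Rule.concl, Finset.forall_mem_insert] at hL hR
    refine ⟨0, by simp [Rule.prems], s, ⟨?_, hR⟩, ?_⟩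
    · have := M.true_box_ndc.1 hL.1
      simpa [Rule.prems] using ⟨this.1, this.2, hL.2⟩
    · rintro τ _ - rfl
      exact ⟨le_rfl, False.elim⟩
  | ndcR Γ Δ π₀ π₁ φ =>
    simp only [Rule.concl, Finset.forall_mem_insert] at hL hR
    -- The assumption is dictated by the branch that a cheapest refutation takes, so the cost of the
    -- traced formula does not grow.
    obtain ⟨t, a, b, h1, h2, h3⟩ := M.eval_cost hR.1
    rcases h1 with h1 | h1
    · have h4 : M.eval (box π₀ φ) s (M.cost (box (ndc π₀ π₁) φ) s) := ⟨t, a, b, h1, h2, h3⟩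
      refine ⟨0, by simp [Rule.prems], s, ⟨hL, ?_⟩, ?_⟩
      · simpa [Rule.prems] using ⟨M.not_true_of_eval h4, hR.2⟩
      · rintro τ τ' - (⟨rfl, rfl⟩ | rfl)
        · exact ⟨M.cost_le h4, False.elim⟩
        · exact ⟨le_rfl, False.elim⟩
    · have h4 : M.eval (box π₁ φ) s (M.cost (box (ndc π₀ π₁) φ) s) := ⟨t, a, b, h1, h2, h3⟩
      refine ⟨1, by simp [Rule.prems], s, ⟨hL, ?_⟩, ?_⟩
      · simpa [Rule.prems] using ⟨M.not_true_of_eval h4, hR.2⟩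
      · rintro τ τ' - (⟨rfl, rfl⟩ | rfl)
        · exact ⟨M.cost_le h4, False.elim⟩
        · exact ⟨le_rfl, False.elim⟩
  | starL Γ Δ π φ =>
    simp only [Rule.concl, Finset.forall_mem_insert] at hL hR
    refine ⟨0, by simp [Rule.prems], s, ⟨?_, hR⟩, ?_⟩
    · have := M.true_box_star.1 hL.1
      simpa [Rule.prems] using ⟨this.1, this.2, hL.2⟩
    · rintro τ _ - rfl
      exact ⟨le_rfl, False.elim⟩
  | caseSplit Γ Δ π φ =>
    simp only [Rule.concl, Finset.forall_mem_insert] at hL hR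
    obtain ⟨t, n, b, h1, h2, h3⟩ := M.eval_cost hR.1
    -- A cheapest run of `π*` stops at once (left assumption) or makes an iteration (right
    -- assumption). In the second case the refutation of `[π][π*]φ` saves the one unit charged by
    -- `StarRun.step`.
    cases h1 with
    | refl =>
      refine ⟨0, by simp [Rule.prems], s, ⟨hL, ?_⟩, ?_⟩
      · simpa [Rule.prems] using ⟨M.not_true_of_eval h2, hR.2⟩
      · rintro τ τ' - (⟨rfl, rfl⟩ | rfl)
        · exact ⟨(M.cost_le h2).trans (by omega), fun h => absurd h.1 (by simp)⟩
        · exact ⟨le_rfl, fun h => absurd h.1 (by simp)⟩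
    | @step _ x _ a a' h4 h5 =>
      have h6 : M.eval (box π (box (star π) φ)) s (a + (a' + b)) :=
        ⟨x, a, a' + b, h4, ⟨t, a', b, h5, h2, rfl⟩, rfl⟩
      have h7 := M.cost_le h6
      refine ⟨1, by simp [Rule.prems], s, ⟨hL, ?_⟩, ?_⟩
      · simpa [Rule.prems] using ⟨M.not_true_of_eval h6, hR.2⟩
      · have h8 : M.cost (box π (box (star π) φ)) s < M.cost (box (star π) φ) s := by omega
        rintro τ τ' - (⟨rfl, rfl⟩ | rfl)
        · exact ⟨h8.le, fun _ => h8⟩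
        · refine ⟨le_rfl, ?_⟩
          rintro ⟨-, h9, h10⟩
          rwa [← h10, ← h9] at h8
  | testL Γ Δ φ ψ =>
    simp only [Rule.concl, Finset.forall_mem_insert] at hL hR
    by_cases hφ : M.True φ s
    · refine ⟨1, by simp [Rule.prems], s, ⟨?_, hR⟩, ?_⟩
      · simpa [Rule.prems] using ⟨(M.true_box_test.1 hL.1) hφ, hL.2⟩
      · rintro τ _ - rfl
        exact ⟨le_rfl, False.elim⟩
    · refine ⟨0, by simp [Rule.prems], s, ⟨hL.2, ?_⟩, ?_⟩
      · simpa [Rule.prems] using ⟨hφ, hR⟩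
      · rintro τ _ - rfl
        exact ⟨le_rfl, False.elim⟩
  | testR Γ Δ φ ψ =>
    simp only [Rule.concl, Finset.forall_mem_insert] at hL hR
    have h1 := hR.1
    rw [true_box_test, Classical.not_imp] at h1
    refine ⟨0, by simp [Rule.prems], s, ⟨?_, ?_⟩, ?_⟩
    · simpa [Rule.prems] using ⟨h1.1, hL⟩
    · simpa [Rule.prems] using ⟨h1.2, hR.2⟩
    · rintro τ τ' hτ (⟨rfl, rfl⟩ | rfl)
      · obtain ⟨t, a, b, ⟨rfl, rfl, -⟩, h3, h4⟩ := M.eval_cost hτ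
        exact ⟨(M.cost_le h3).trans (by omega), False.elim⟩
      · exact ⟨le_rfl, False.elim⟩

/-- The node of the derivation graph represented by a node of the tree is inner or an axiom and
carries the same sequent. -/
theorem _root_.CGPDL.PreProof.toGraph_spec (D : PreProof P A) {σ : List ℕ} (h : σ ∈ D.nodes) :
    D.toGraph σ ∈ D.nodes ∧
      ∃ r, D.label (D.toGraph σ) = .rule r ∧ r.concl = (D.label σ).seq := by
  cases hl : D.label σ with
  | bud S =>
    obtain ⟨h1, r, h2, -, h3⟩ := D.companion_spec σ S h hl
    simp only [PreProof.toGraph, hl]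
    exact ⟨h1, r, h2, h3⟩
  | rule r =>
    simp only [PreProof.toGraph, hl]
    exact ⟨h, r, rfl, rfl⟩

/-- Soundness: a provable sequent is not refuted in any Kripke model. -/
theorem not_refutes_of_provable {S : Sequent P A} (hS : Provable S) (s : W) :
    ¬ M.Refutes s S := by
  obtain ⟨D, rfl, hD⟩ := hS
  intro h
  -- Pairs of a rule node and a state refuting its sequent; every such pair has a successor, which
  -- yields an infinite path.
  let X := {x : List ℕ × W // x.1 ∈ D.nodes ∧
    ∃ r, D.label x.1 = .rule r ∧ M.Refutes x.2 r.concl}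
  have hstep : ∀ x : X, ∃ (j : ℕ) (y : X), ∃ r, D.label x.1.1 = .rule r ∧ j < r.prems.length ∧
      y.1.1 = D.toGraph (j :: x.1.1) ∧ ∀ τ ∈ r.concl.suc, ∀ τ', r.TraceStep j τ τ' →
        M.cost τ' y.1.2 ≤ M.cost τ x.1.2 ∧
        (r.Progress j τ τ' → M.cost τ' y.1.2 < M.cost τ x.1.2) := by
    rintro ⟨⟨σ, s⟩, hσ, r, hr, hs⟩
    obtain ⟨j, hj, t, h1, h2⟩ := M.exists_refutes_prem r s hs
    obtain ⟨h3, r', h4, h5⟩ := D.toGraph_spec ((D.child_mem j σ).2 ⟨hσ, r, hr, hj⟩)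
    rw [D.child_seq σ r hσ hr j hj] at h5
    exact ⟨j, ⟨⟨_, t⟩, h3, r', h4, by rw [h5]; exact h1⟩, r, hr, hj, rfl,
      fun τ hτ τ' hs' => h2 τ τ' (hs.2 τ hτ) hs'⟩
  choose dir next rule hrule hdir hnext hcost using hstep
  obtain ⟨h1, r, h2, h3⟩ := D.toGraph_spec D.root_mem
  let x₀ : X := ⟨⟨_, s⟩, h1, r, h2, by rw [h3]; exact h⟩
  let x : ℕ → X := fun n => Nat.rec x₀ (fun _ y => next y) n
  obtain ⟨k, τ, hτ, hprog⟩ := hD (fun i => (x i).1.1) (fun i => dir (x i))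
    fun i => ⟨(x i).2.1, rule (x i), hrule _, hdir _, hnext _⟩
  have hmem : ∀ i, k ≤ i → τ i ∈ (rule (x i)).concl.suc := fun i hi => by
    have := (hτ i hi).1
    rw [hrule] at this
    exact this
  have hle := fun i hi => hcost (x i) (τ i) (hmem i hi) (τ (i + 1)) ((hτ i hi).2 _ (hrule _))
  -- The cost along the trace becomes constant, so no progress point can follow.
  obtain ⟨N, hN, hconst⟩ := exists_eventually_const (f := fun i => M.cost (τ i) (x i).1.2) (N := k)
    fun i hi => (hle i hi).1
  obtain ⟨i, hi, hk, r, hr, hp⟩ := hprog N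
  have : r = rule (x i) := by
    have := hr.symm.trans (hrule (x i))
    exact Label.rule.inj this
  subst this
  exact ((hle i hk).2 hp).ne (hconst i hi)

end Kripke

end Soundness

/-! ### Fischer–Ladner closure, saturation rules and support -/

section Closure

variable {P : Type u} {A : Type v}

/-- The formulas to which a formula is reduced by the rules of the system. -/
noncomputable def reducts : Formula P A → Finset (Formula P A)
  | .bot => ∅
  | .var _ => ∅
  | .imp φ ψ => {φ, ψ}
  | .box (.atom _) φ => {φ}
  | .box (.seq π₀ π₁) φ => {box π₀ (box π₁ φ)}
  | .box (.ndc π₀ π₁) φ => {box π₀ φ, box π₁ φ}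
  | .box (.star π) φ => {φ, box π (box (star π) φ)}
  | .box (.test φ) ψ => {φ, ψ}

/-- A set of formulas is closed under the rules of the system. -/
def Closed (C : Finset (Formula P A)) : Prop := ∀ φ ∈ C, reducts φ ⊆ C

/-- The type of Fischer–Ladner closures: for a program `π`, a set of formulas depending on the
formula to which `[π]` is applied. -/
abbrev ClosureType (P : Type u) (A : Type v) : Kind → Type (max u v)
  | .formula => Finset (Formula P A)
  | .program => Formula P A → Finset (Formula P A)

/-- The Fischer–Ladner closure. For a program `π` and a formula `φ`, it consists of the formulas
reached from `[π]φ` before `φ`. -/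
noncomputable def flClosure : {k : Kind} → Expr P A k → ClosureType P A k
  | _, .bot => ({bot} : Finset (Formula P A))
  | _, .var p => ({var p} : Finset (Formula P A))
  | _, .imp φ ψ => (insert (imp φ ψ) (flClosure φ ∪ flClosure ψ) : Finset (Formula P A))
  | _, .box π φ => (flClosure π φ ∪ flClosure φ : Finset (Formula P A))
  | _, .atom a => fun φ => {box (atom a) φ}
  | _, .seq π₀ π₁ => fun φ =>
      insert (box (seq π₀ π₁) φ) (flClosure π₀ (box π₁ φ) ∪ flClosure π₁ φ)
  | _, .ndc π₀ π₁ => fun φ => insert (box (ndc π₀ π₁) φ) (flClosure π₀ φ ∪ flClosure π₁ φ)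
  | _, .star π => fun φ => insert (box (star π) φ) (flClosure π (box (star π) φ))
  | _, .test ψ => fun φ => insert (box (test ψ) φ) (flClosure ψ)

/-- The defining properties of the Fischer–Ladner closure. -/
def ClosureSpec : (k : Kind) → Expr P A k → Prop
  | .formula, φ => φ ∈ (flClosure φ : Finset (Formula P A)) ∧
      ∀ χ ∈ (flClosure φ : Finset (Formula P A)), reducts χ ⊆ flClosure φ
  | .program, π => ∀ φ : Formula P A, box π φ ∈ flClosure π φ ∧
      ∀ χ ∈ flClosure π φ, ∀ θ ∈ reducts χ, θ = φ ∨ θ ∈ flClosure π φ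

/-- Letting reductions of `[π]φ` exit at `φ` makes the induction structural: for `π₀;π₁` the closure
of `π₀` exits at `[π₁]φ`, and for `π*` the closure of `π` exits at `[π*]φ`, which is already
present. -/
theorem closureSpec : ∀ {k : Kind} (e : Expr P A k), ClosureSpec k e
  | _, .bot => by simp [ClosureSpec, flClosure, reducts]
  | _, .var p => by simp [ClosureSpec, flClosure, reducts]
  | _, .imp φ ψ => by
    obtain ⟨h1, h2⟩ := closureSpec φ
    obtain ⟨h3, h4⟩ := closureSpec ψ
    refine ⟨Finset.mem_insert_self _ _, fun χ hχ θ hθ => ?_⟩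
    simp only [flClosure, Finset.mem_insert, Finset.mem_union] at hχ ⊢
    rcases hχ with rfl | hχ | hχ
    · simp only [reducts, Finset.mem_insert, Finset.mem_singleton] at hθ
      rcases hθ with rfl | rfl <;> tauto
    · exact Or.inr (Or.inl (h2 χ hχ hθ))
    · exact Or.inr (Or.inr (h4 χ hχ hθ))
  | _, .box π φ => by
    obtain ⟨h1, h2⟩ := closureSpec π φ
    obtain ⟨h3, h4⟩ := closureSpec φ
    refine ⟨Finset.mem_union_left _ h1, fun χ hχ θ hθ => ?_⟩
    simp only [flClosure, Finset.mem_union] at hχ ⊢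
    rcases hχ with hχ | hχ
    · rcases h2 χ hχ θ hθ with rfl | h
      · exact Or.inr h3
      · exact Or.inl h
    · exact Or.inr (h4 χ hχ hθ)
  | _, .atom a => by simp [ClosureSpec, flClosure, reducts]
  | _, .seq π₀ π₁ => by
    intro φ
    obtain ⟨h1, h2⟩ := closureSpec π₀ (box π₁ φ)
    obtain ⟨h3, h4⟩ := closureSpec π₁ φ
    refine ⟨Finset.mem_insert_self _ _, fun χ hχ θ hθ => ?_⟩
    simp only [flClosure, Finset.mem_insert, Finset.mem_union] at hχ ⊢
    rcases hχ with rfl | hχ | hχ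
    · simp only [reducts, Finset.mem_singleton] at hθ
      subst hθ
      tauto
    · rcases h2 χ hχ θ hθ with rfl | h <;> tauto
    · rcases h4 χ hχ θ hθ with rfl | h <;> tauto
  | _, .ndc π₀ π₁ => by
    intro φ
    obtain ⟨h1, h2⟩ := closureSpec π₀ φ
    obtain ⟨h3, h4⟩ := closureSpec π₁ φ
    refine ⟨Finset.mem_insert_self _ _, fun χ hχ θ hθ => ?_⟩
    simp only [flClosure, Finset.mem_insert, Finset.mem_union] at hχ ⊢
    rcases hχ with rfl | hχ | hχ
    · simp only [reducts, Finset.mem_insert, Finset.mem_singleton] at hθ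
      rcases hθ with rfl | rfl <;> tauto
    · rcases h2 χ hχ θ hθ with rfl | h <;> tauto
    · rcases h4 χ hχ θ hθ with rfl | h <;> tauto
  | _, .star π => by
    intro φ
    obtain ⟨h1, h2⟩ := closureSpec π (box (star π) φ)
    refine ⟨Finset.mem_insert_self _ _, fun χ hχ θ hθ => ?_⟩
    simp only [flClosure, Finset.mem_insert] at hχ ⊢
    rcases hχ with rfl | hχ
    · simp only [reducts, Finset.mem_insert, Finset.mem_singleton] at hθ
      rcases hθ with rfl | rfl <;> tauto
    · rcases h2 χ hχ θ hθ with rfl | h <;> tauto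
  | _, .test ψ => by
    intro φ
    obtain ⟨h1, h2⟩ := closureSpec ψ
    refine ⟨Finset.mem_insert_self _ _, fun χ hχ θ hθ => ?_⟩
    simp only [flClosure, Finset.mem_insert] at hχ ⊢
    rcases hχ with rfl | hχ
    · simp only [reducts, Finset.mem_insert, Finset.mem_singleton] at hθ
      rcases hθ with rfl | rfl <;> tauto
    · exact Or.inr (Or.inr (h2 χ hχ hθ))

theorem exists_closed_superset (X : Finset (Formula P A)) : ∃ C, Closed C ∧ X ⊆ C := by
  refine ⟨X.biUnion fun φ => flClosure φ, fun χ hχ θ hθ => ?_, fun φ hφ => ?_⟩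
  · rw [Finset.mem_biUnion] at hχ ⊢
    obtain ⟨φ, h1, h2⟩ := hχ
    exact ⟨φ, h1, (closureSpec φ).2 χ h2 hθ⟩
  · exact Finset.mem_biUnion.2 ⟨φ, hφ, (closureSpec φ).1⟩

/-- A size of expressions that is decreased by all reductions except the unfolding of a star. -/
def size : {k : Kind} → Expr P A k → ℕ
  | _, .bot => 0
  | _, .var _ => 0
  | _, .imp φ ψ => size φ + size ψ + 1
  | _, .box π φ => size π + size φ
  | _, .atom _ => 1
  | _, .seq π₀ π₁ => size π₀ + size π₁ + 1
  | _, .ndc π₀ π₁ => size π₀ + size π₁ + 1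
  | _, .star π => size π + 1
  | _, .test _ => 1

/-- All tests occurring in a program have the property `G`. -/
def TestsSatisfy (G : Formula P A → Prop) : {k : Kind} → Expr P A k → Prop
  | _, .seq π₀ π₁ => TestsSatisfy G π₀ ∧ TestsSatisfy G π₁
  | _, .ndc π₀ π₁ => TestsSatisfy G π₀ ∧ TestsSatisfy G π₁
  | _, .star π => TestsSatisfy G π
  | _, .test φ => G φ
  | _, _ => True

/-- The formulas `[π₁]…[πₙ]χ` such that all tests in the programs have the property `G`. -/
inductive Boxed (G : Formula P A → Prop) (χ : Formula P A) : Formula P A → Prop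
  | base : Boxed G χ χ
  | box {π : Program P A} {φ : Formula P A} :
      TestsSatisfy G π → Boxed G χ φ → Boxed G χ (box π φ)

/-- Inclusion of sequents. -/
def Incl (S T : Sequent P A) : Prop := S.ant ⊆ T.ant ∧ S.suc ⊆ T.suc

theorem Incl.trans {S T U : Sequent P A} (h : Incl S T) (h' : Incl T U) : Incl S U :=
  ⟨h.1.trans h'.1, h.2.trans h'.2⟩

/-- The sequent consists of formulas from `C`. -/
def Over (C : Finset (Formula P A)) (S : Sequent P A) : Prop := S.ant ⊆ C ∧ S.suc ⊆ C

/-- The number of formulas in a sequent. -/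
def card (S : Sequent P A) : ℕ := S.ant.card + S.suc.card

theorem Incl.eq_of_card_le {S T : Sequent P A} (h : Incl S T) (hc : card T ≤ card S) : T = S := by
  have h1 := Finset.card_le_card h.1
  have h2 := Finset.card_le_card h.2
  unfold card at hc
  ext1
  · exact (Finset.eq_of_subset_of_card_le h.1 (by omega)).symm
  · exact (Finset.eq_of_subset_of_card_le h.2 (by omega)).symm

theorem Over.card_le {C : Finset (Formula P A)} {S : Sequent P A} (h : Over C S) :
    card S ≤ 2 * C.card := by
  have h1 := Finset.card_le_card h.1
  have h2 := Finset.card_le_card h.2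
  unfold card
  omega

theorem finite_over (C : Finset (Formula P A)) : {S : Sequent P A | Over C S}.Finite := by
  refine ((C.powerset.finite_toSet.prod C.powerset.finite_toSet).image
    fun x => (⟨x.1, x.2⟩ : Sequent P A)).subset ?_
  rintro ⟨Γ, Δ⟩ ⟨h1, h2⟩
  exact ⟨(Γ, Δ), by simpa using ⟨h1, h2⟩, rfl⟩

/-- The left rule instances with conclusion `S` that keep their principal formula. -/
inductive LeftExp (S : Sequent P A) : Rule P A → Prop
  | impL {φ ψ : Formula P A} : imp φ ψ ∈ S.ant → LeftExp S (.impL S.ant S.suc φ ψ)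
  | seqL {π₀ π₁ : Program P A} {φ : Formula P A} :
      box (seq π₀ π₁) φ ∈ S.ant → LeftExp S (.seqL S.ant S.suc π₀ π₁ φ)
  | ndcL {π₀ π₁ : Program P A} {φ : Formula P A} :
      box (ndc π₀ π₁) φ ∈ S.ant → LeftExp S (.ndcL S.ant S.suc π₀ π₁ φ)
  | starL {π : Program P A} {φ : Formula P A} :
      box (star π) φ ∈ S.ant → LeftExp S (.starL S.ant S.suc π φ)
  | testL {φ ψ : Formula P A} : box (test φ) ψ ∈ S.ant → LeftExp S (.testL S.ant S.suc φ ψ)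

/-- The right rule instances with conclusion `S` and a given principal formula, which they keep. -/
inductive RightExp (S : Sequent P A) : Formula P A → Rule P A → Prop
  | impR {φ ψ : Formula P A} : imp φ ψ ∈ S.suc → RightExp S (imp φ ψ) (.impR S.ant S.suc φ ψ)
  | seqR {π₀ π₁ : Program P A} {φ : Formula P A} : box (seq π₀ π₁) φ ∈ S.suc →
      RightExp S (box (seq π₀ π₁) φ) (.seqR S.ant S.suc π₀ π₁ φ)
  | ndcR {π₀ π₁ : Program P A} {φ : Formula P A} : box (ndc π₀ π₁) φ ∈ S.suc →
      RightExp S (box (ndc π₀ π₁) φ) (.ndcR S.ant S.suc π₀ π₁ φ)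
  | caseSplit {π : Program P A} {φ : Formula P A} : box (star π) φ ∈ S.suc →
      RightExp S (box (star π) φ) (.caseSplit S.ant S.suc π φ)
  | testR {φ ψ : Formula P A} : box (test φ) ψ ∈ S.suc →
      RightExp S (box (test φ) ψ) (.testR S.ant S.suc φ ψ)

/-- A formula is well-foundedly supported by a sequent that refutes it: its decomposition by right
rules within the sequent ends in irreducible formulas of the consequent. -/
inductive Supp (S : Sequent P A) : Formula P A → Prop
  | bot : bot ∈ S.suc → Supp S bot
  | var {p : P} : var p ∈ S.suc → Supp S (var p)
  | imp {φ ψ : Formula P A} : φ ∈ S.ant → Supp S ψ → Supp S (imp φ ψ)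
  | atom {a : A} {φ : Formula P A} : box (atom a) φ ∈ S.suc → Supp S (box (atom a) φ)
  | seq {π₀ π₁ : Program P A} {φ : Formula P A} :
      Supp S (box π₀ (box π₁ φ)) → Supp S (box (seq π₀ π₁) φ)
  | ndcLeft {π₀ π₁ : Program P A} {φ : Formula P A} :
      Supp S (box π₀ φ) → Supp S (box (ndc π₀ π₁) φ)
  | ndcRight {π₀ π₁ : Program P A} {φ : Formula P A} :
      Supp S (box π₁ φ) → Supp S (box (ndc π₀ π₁) φ)
  | starExit {π : Program P A} {φ : Formula P A} : Supp S φ → Supp S (box (star π) φ)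
  | starUnfold {π : Program P A} {φ : Formula P A} :
      Supp S (box π (box (star π) φ)) → Supp S (box (star π) φ)
  | test {φ ψ : Formula P A} : φ ∈ S.ant → Supp S ψ → Supp S (box (test φ) ψ)

/-- Formulas of the consequent to which no right expansion applies are supported outright. -/
theorem exists_rightExp {S : Sequent P A} : ∀ {σ : Formula P A}, σ ∈ S.suc → ¬ Supp S σ →
    ∃ r, RightExp S σ r
  | .bot, h, hs => absurd (.bot h) hs
  | .var _, h, hs => absurd (.var h) hs
  | .imp _ _, h, _ => ⟨_, .impR h⟩
  | .box (.atom _) _, h, hs => absurd (.atom h) hs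
  | .box (.seq _ _) _, h, _ => ⟨_, .seqR h⟩
  | .box (.ndc _ _) _, h, _ => ⟨_, .ndcR h⟩
  | .box (.star _) _, h, _ => ⟨_, .caseSplit h⟩
  | .box (.test _) _, h, _ => ⟨_, .testR h⟩

theorem exists_rightExp_box {S : Sequent P A} {π : Program P A} {φ : Formula P A}
    (h : box π φ ∈ S.suc) (hπ : ∀ a, π ≠ atom a) : ∃ r, RightExp S (box π φ) r :=
  match π with
  | .atom a => absurd rfl (hπ a)
  | .seq _ _ => ⟨_, .seqR h⟩
  | .ndc _ _ => ⟨_, .ndcR h⟩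
  | .star _ => ⟨_, .caseSplit h⟩
  | .test _ => ⟨_, .testR h⟩

theorem LeftExp.not_isCut {S : Sequent P A} {r : Rule P A} (h : LeftExp S r) : ¬ r.IsCut := by
  cases h <;> exact id

theorem LeftExp.concl_eq {S : Sequent P A} {r : Rule P A} (h : LeftExp S r) : r.concl = S := by
  cases h <;> simp [Rule.concl, *]

theorem LeftExp.traceStep {S : Sequent P A} {r : Rule P A} (h : LeftExp S r) (j : ℕ)
    (τ : Formula P A) : r.TraceStep j τ τ := by
  cases h <;> rfl

theorem LeftExp.incl {S : Sequent P A} {r : Rule P A} (h : LeftExp S r) {T : Sequent P A}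
    (hT : T ∈ r.prems) : Incl S T := by
  cases h <;> simp only [Rule.prems, List.mem_cons, List.not_mem_nil, or_false] at hT <;>
    rcases hT with rfl | rfl <;> constructor <;> intro φ hφ <;> simp [hφ]

theorem LeftExp.over {C : Finset (Formula P A)} (hC : Closed C) {S : Sequent P A} (hS : Over C S)
    {r : Rule P A} (h : LeftExp S r) {T : Sequent P A} (hT : T ∈ r.prems) : Over C T := by
  cases h with
  | _ h =>
    have h' := hC _ (hS.1 h)
    simp only [reducts, Finset.insert_subset_iff, Finset.singleton_subset_iff] at h'
    simp only [Rule.prems, List.mem_cons, List.not_mem_nil, or_false] at hT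
    rcases hT with rfl | rfl <;> constructor <;>
      simp only [Finset.insert_subset_iff, hS.1, hS.2, h', and_self]

theorem RightExp.not_isCut {S : Sequent P A} {σ : Formula P A} {r : Rule P A}
    (h : RightExp S σ r) : ¬ r.IsCut := by
  cases h <;> exact id

theorem RightExp.concl_eq {S : Sequent P A} {σ : Formula P A} {r : Rule P A}
    (h : RightExp S σ r) : r.concl = S := by
  cases h <;> simp [Rule.concl, *]

theorem RightExp.traceStep {S : Sequent P A} {σ : Formula P A} {r : Rule P A}
    (h : RightExp S σ r) (j : ℕ) (τ : Formula P A) : r.TraceStep j τ τ := by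
  cases h <;> exact Or.inr rfl

theorem RightExp.incl {S : Sequent P A} {σ : Formula P A} {r : Rule P A}
    (h : RightExp S σ r) {T : Sequent P A} (hT : T ∈ r.prems) : Incl S T := by
  cases h <;> simp only [Rule.prems, List.mem_cons, List.not_mem_nil, or_false] at hT <;>
    rcases hT with rfl | rfl <;> constructor <;> intro φ hφ <;> simp [hφ]

theorem RightExp.over {C : Finset (Formula P A)} (hC : Closed C) {S : Sequent P A}
    (hS : Over C S) {σ : Formula P A} {r : Rule P A} (h : RightExp S σ r) {T : Sequent P A}
    (hT : T ∈ r.prems) : Over C T := by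
  cases h with
  | _ h =>
    have h' := hC _ (hS.2 h)
    simp only [reducts, Finset.insert_subset_iff, Finset.singleton_subset_iff] at h'
    simp only [Rule.prems, List.mem_cons, List.not_mem_nil, or_false] at hT
    rcases hT with rfl | rfl <;> constructor <;>
      simp only [Finset.insert_subset_iff, hS.1, hS.2, h', and_self]

/-- A trace step that rewrites the principal formula of a right rule. -/
theorem RightExp.exists_focus {S : Sequent P A} {σ : Formula P A} {r : Rule P A}
    (h : RightExp S σ r) {W : Type w} (M : Kripke P A W) {j : ℕ} (hj : j < r.prems.length) :
    ∃ σ' ∈ r.prems[j].suc, r.TraceStep j σ σ' ∧ (r.Progress j σ σ' ∨ size σ' < size σ) ∧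
      (r.prems[j] = S → Supp S σ' → Supp S σ) ∧
      ∀ π φ, σ = box π φ → ∀ G χ, TestsSatisfy G π → Boxed G χ φ → Boxed G χ σ' ∧
        ∀ s, (∀ ψ ∈ r.prems[j].ant, G ψ → M.True ψ s) → M.True σ s → M.True σ' s := by
  cases h with
  | @impR φ ψ h =>
    obtain rfl : j = 0 := by simpa [Rule.prems] using hj
    refine ⟨ψ, Finset.mem_insert_self _ _, Or.inl ⟨rfl, rfl⟩, Or.inr ?_, fun h1 h2 => ?_, ?_⟩
    · simp only [size]
      omega
    · exact .imp (by rw [← h1]; exact Finset.mem_insert_self _ _) h2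
    · rintro π φ ⟨⟩
  | @seqR π₀ π₁ φ h =>
    obtain rfl : j = 0 := by simpa [Rule.prems] using hj
    refine ⟨_, Finset.mem_insert_self _ _, Or.inl ⟨rfl, rfl⟩, Or.inr ?_, fun _ h2 => .seq h2, ?_⟩
    · simp only [size]
      omega
    · rintro π φ ⟨⟩ G χ h1 h2
      exact ⟨.box h1.1 (.box h1.2 h2), fun s _ => M.true_box_seq.1⟩
  | @ndcR π₀ π₁ φ h =>
    rcases j with _ | _ | j
    · refine ⟨_, Finset.mem_insert_self _ _, Or.inl ⟨rfl, rfl⟩, Or.inr ?_,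
        fun _ h2 => .ndcLeft h2, ?_⟩
      · simp only [size]
        omega
      · rintro π φ ⟨⟩ G χ h1 h2
        exact ⟨.box h1.1 h2, fun s _ h3 => (M.true_box_ndc.1 h3).1⟩
    · refine ⟨_, Finset.mem_insert_self _ _, Or.inl ⟨rfl, rfl⟩, Or.inr ?_,
        fun _ h2 => .ndcRight h2, ?_⟩
      · simp only [size]
        omega
      · rintro π φ ⟨⟩ G χ h1 h2
        exact ⟨.box h1.2 h2, fun s _ h3 => (M.true_box_ndc.1 h3).2⟩
    · simp [Rule.prems] at hj
  | @caseSplit π φ h =>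
    rcases j with _ | _ | j
    · refine ⟨_, Finset.mem_insert_self _ _, Or.inl ⟨rfl, rfl⟩, Or.inr ?_,
        fun _ h2 => .starExit h2, ?_⟩
      · simp only [size]
        omega
      · rintro π φ ⟨⟩ G χ h1 h2
        exact ⟨h2, fun s _ h3 => (M.true_box_star.1 h3).1⟩
    -- The only reduct that need not be smaller; here the step is a progress point.
    · refine ⟨_, Finset.mem_insert_self _ _, Or.inl ⟨rfl, rfl⟩, Or.inl ⟨rfl, rfl, rfl⟩,
        fun _ h2 => .starUnfold h2, ?_⟩
      rintro π φ ⟨⟩ G χ h1 h2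
      exact ⟨.box h1 (.box h1 h2), fun s _ h3 => (M.true_box_star.1 h3).2⟩
    · simp [Rule.prems] at hj
  | @testR φ ψ h =>
    obtain rfl : j = 0 := by simpa [Rule.prems] using hj
    refine ⟨ψ, Finset.mem_insert_self _ _, Or.inl ⟨rfl, rfl⟩, Or.inr ?_, fun h1 h2 => ?_, ?_⟩
    · simp only [size]
      omega
    · exact .test (by rw [← h1]; exact Finset.mem_insert_self _ _) h2
    · rintro π φ ⟨⟩ G χ h1 h2
      -- The test has moved to the antecedent and satisfies `G`, hence it is true at `s`. This is
      -- why `Boxed` restricts the tests.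
      exact ⟨h2, fun s h3 h4 => M.true_box_test.1 h4 (h3 _ (Finset.mem_insert_self _ _) h1)⟩

end Closure

/-! ### Canonical model, truth lemma and cut-free completeness -/

section Completeness

variable {P : Type u} {A : Type v}

/-- The left rules add nothing to the sequent. -/
def LeftSaturated (S : Sequent P A) : Prop := ∀ r, LeftExp S r → S ∈ r.prems

/-- The states of the canonical model: unprovable saturated sequents. -/
structure State (C : Finset (Formula P A)) where
  seq : Sequent P A
  subset : Over C seq
  unprovable : ¬ GraphProvable seq
  leftSaturated : LeftSaturated seq
  supp : ∀ φ ∈ seq.suc, Supp seq φ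

/-- The canonical model. -/
def canonical (C : Finset (Formula P A)) : Kripke P A (State C) where
  trans a s t := ∀ φ, box (atom a) φ ∈ s.seq.ant → φ ∈ t.seq.ant
  val p s := var p ∈ s.seq.ant

variable {C : Finset (Formula P A)}

theorem State.disjoint (s : State C) {φ : Formula P A} (h1 : φ ∈ s.seq.ant)
    (h2 : φ ∈ s.seq.suc) : False :=
  s.unprovable (GraphProvable.of_rule
    (r := .ax s.seq.ant s.seq.suc ⟨φ, Finset.mem_inter.2 ⟨h1, h2⟩⟩) id
    fun j hj => absurd hj (Nat.not_lt_zero j))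

theorem State.bot_notMem (s : State C) : bot ∉ s.seq.ant := by
  intro h
  have h1 := GraphProvable.of_rule (r := .botL s.seq.ant s.seq.suc) id
    fun j hj => absurd hj (Nat.not_lt_zero j)
  simp only [Rule.concl, Finset.insert_eq_of_mem h] at h1
  exact s.unprovable h1

/-- A largest unprovable extension `T` over `C` works. If a left rule added something to every
assumption, all assumptions would be provable, and so would `T`. If some formula of the consequent
were unsupported, the unsupported formulas would form a focus system at the fixed sequent `T`: each
right rule leads to provable larger sequents or back to `T` with an unsupported reduct, which makes
`T` provable. -/
theorem exists_state (hC : Closed C) {S : Sequent P A} (hS : Over C S)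
    (hn : ¬ GraphProvable S) : ∃ t : State C, Incl S t.seq := by
  obtain ⟨T, ⟨hT, hTn, hST⟩, hmax⟩ := Set.exists_max_image
    {T : Sequent P A | Over C T ∧ ¬ GraphProvable T ∧ Incl S T} card
    ((finite_over C).subset fun T h => h.1) ⟨S, hS, hn, subset_rfl, subset_rfl⟩
  have hmax' : ∀ U, Over C U → ¬ GraphProvable U → Incl T U → U = T := fun U h1 h2 h3 =>
    h3.eq_of_card_le (hmax U ⟨h1, h2, hST.trans h3⟩)
  refine ⟨⟨T, hT, hTn, fun r hr => ?_, fun φ hφ => ?_⟩, hST⟩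
  · by_contra hnot
    refine hTn (hr.concl_eq ▸ GraphProvable.of_rule hr.not_isCut fun j hj => ?_)
    by_contra hj'
    have hmem := List.getElem_mem hj
    exact hnot (hmax' _ (hr.over hC hT hmem) hj' (hr.incl hmem) ▸ hmem)
  · by_contra hsup
    have : Finite {σ // σ ∈ T.suc ∧ ¬ Supp T σ} :=
      (T.suc.finite_toSet.subset fun σ h => h.1 : {σ | σ ∈ T.suc ∧ ¬ Supp T σ}.Finite)
    refine hTn (FocusSystem.graphProvable (V := {σ // σ ∈ T.suc ∧ ¬ Supp T σ})
      ⟨fun _ => T, fun σ => σ, fun σ => σ, fun σ => size σ.1, fun _ => 0⟩ ?_ ⟨φ, hφ, hsup⟩)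
    rintro ⟨σ, hσ, hσn⟩
    obtain ⟨r, hr⟩ := exists_rightExp hσ hσn
    refine ⟨r, hr.not_isCut, hr.concl_eq, fun j hj => or_iff_not_imp_left.2 fun hj' => ?_⟩
    have hmem := List.getElem_mem hj
    have heq := hmax' _ (hr.over hC hT hmem) hj' (hr.incl hmem)
    -- The choice of model is immaterial: the clause about truth is discarded.
    obtain ⟨σ', h1, h2, h3, h4, -⟩ := hr.exists_focus (canonical C) hj
    refine ⟨⟨σ', heq ▸ h1, fun h => hσn (h4 heq h)⟩, heq.symm, hσ, h2, ?_⟩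
    exact h3.imp_right Or.inl

open Classical in
/-- The rule `(K)` applied to an atomic program, with as many formulas as possible. -/
noncomputable def maximalK (C : Finset (Formula P A)) (S : Sequent P A) (a : A)
    (φ : Formula P A) : Rule P A :=
  .boxK (C.filter fun ψ => box (atom a) ψ ∈ S.ant) S.ant S.suc (atom a) φ

theorem maximalK_concl {S : Sequent P A} {a : A} {φ : Formula P A}
    (h : box (atom a) φ ∈ S.suc) : (maximalK C S a φ).concl = S := by
  ext1
  · refine Finset.union_eq_left.2 fun ψ hψ => ?_
    obtain ⟨θ, hθ, rfl⟩ := Finset.mem_image.1 hψ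
    exact (Finset.mem_filter.1 hθ).2
  · exact Finset.insert_eq_of_mem h

theorem maximalK_prem_over (hC : Closed C) {S : Sequent P A} (hS : Over C S) {a : A}
    {φ : Formula P A} (h : box (atom a) φ ∈ S.suc) {T : Sequent P A}
    (hT : T ∈ (maximalK C S a φ).prems) : Over C T ∧ φ ∈ T.suc := by
  obtain rfl := List.mem_singleton.1 hT
  refine ⟨⟨Finset.filter_subset _ _, ?_⟩, Finset.mem_singleton_self _⟩
  exact hC _ (hS.2 h)

/-- The assumption collects every `ψ` with `[a]ψ` in the antecedent of `s`, so each state extending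
it is an `a`-successor of `s`. -/
theorem maximalK_prem_true (hC : Closed C) {s : State C} {a : A} {φ : Formula P A}
    (h : (canonical C).True (box (atom a) φ) s) {T : Sequent P A}
    (hT : T ∈ (maximalK C s.seq a φ).prems) {t : State C} (ht : Incl T t.seq) :
    (canonical C).True φ t := by
  obtain rfl := List.mem_singleton.1 hT
  refine (canonical C).true_box.1 h t 0 ⟨fun ψ hψ => ht.1 (Finset.mem_filter.2 ⟨?_, hψ⟩), rfl⟩
  exact hC _ (s.subset.1 hψ) (Finset.mem_singleton_self _)

/-- A sequent over `C` is provable if its extensions to states satisfy one of its formulas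
`[π₁]…[πₙ]χ` where `χ` and the tests in the programs satisfy the truth lemma. -/
theorem graphProvable_of_true (hC : Closed C) {G : Formula P A → Prop} {χ : Formula P A}
    (hG : ∀ ψ, G ψ → ∀ t : State C, ψ ∈ t.seq.ant → (canonical C).True ψ t)
    (hχ : ∀ t : State C, χ ∈ t.seq.suc → ¬ (canonical C).True χ t)
    {S : Sequent P A} {τ : Formula P A} (hS : Over C S) (hτ : τ ∈ S.suc) (hb : Boxed G χ τ)
    (ht : ∀ t : State C, Incl S t.seq → (canonical C).True τ t) : GraphProvable S := by
  classical
  by_contra hn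
  -- A vertex is an unprovable sequent with a main focus true in all states extending it. The
  -- secondary focus is an unsupported formula, if there is one.
  let V := {x : Sequent P A × Formula P A × Formula P A // Over C x.1 ∧ ¬ GraphProvable x.1 ∧
    x.2.1 ∈ x.1.suc ∧ Boxed G χ x.2.1 ∧
    (∀ t : State C, Incl x.1 t.seq → (canonical C).True x.2.1 t) ∧
    x.2.2 ∈ x.1.suc ∧ ((∀ φ ∈ x.1.suc, Supp x.1 φ) ∨ ¬ Supp x.1 x.2.2)}
  have : Finite V := by
    refine Set.Finite.subset ((finite_over C).prod (C.finite_toSet.prod C.finite_toSet)) ?_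
    rintro x ⟨h1, -, h2, -, -, h3, -⟩
    exact ⟨h1, h1.2 h2, h1.2 h3⟩
  let K := 2 * C.card
  -- The main rank encodes a lexicographic order: first the size of the main focus, then the room
  -- left for the sequent to grow, which is at most `K`.
  let F : FocusSystem P A V := ⟨fun x => x.1.1, fun x => x.1.2.1, fun x => x.1.2.2,
    fun x => size x.1.2.1 * (K + 1) + (K - card x.1.1), fun x => size x.1.2.2⟩
  have enter : ∀ (S : Sequent P A) (τ : Formula P A), Over C S → ¬ GraphProvable S → τ ∈ S.suc →
      Boxed G χ τ → (∀ t : State C, Incl S t.seq → (canonical C).True τ t) →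
      ∃ x : V, F.seq x = S ∧ F.focus x = τ := by
    intro S τ h1 h2 h3 h4 h5
    by_cases h : ∀ φ ∈ S.suc, Supp S φ
    · exact ⟨⟨(S, τ, τ), h1, h2, h3, h4, h5, h3, Or.inl h⟩, rfl, rfl⟩
    · push Not at h
      obtain ⟨σ, h6, h7⟩ := h
      exact ⟨⟨(S, τ, σ), h1, h2, h3, h4, h5, h6, Or.inr h7⟩, rfl, rfl⟩
  have rank_of_size : ∀ x y : V, size (F.focus y) < size (F.focus x) → F.rank y < F.rank x := by
    intro x y h
    have h1 : (size (F.focus y) + 1) * (K + 1) ≤ size (F.focus x) * (K + 1) :=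
      Nat.mul_le_mul_right _ h
    change size (F.focus y) * (K + 1) + (K - card y.1.1) <
      size (F.focus x) * (K + 1) + (K - card x.1.1)
    rw [add_mul, one_mul] at h1
    omega
  have rank_of_card : ∀ x y : V, F.focus y = F.focus x → Incl (F.seq x) (F.seq y) →
      F.seq y ≠ F.seq x → F.rank y < F.rank x := by
    intro x y h1 h2 h3
    have h4 : ¬ card y.1.1 ≤ card x.1.1 := fun h => h3 (h2.eq_of_card_le h)
    have h5 : card y.1.1 ≤ K := y.2.1.card_le
    change size (F.focus y) * (K + 1) + (K - card y.1.1) <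
      size (F.focus x) * (K + 1) + (K - card x.1.1)
    rw [h1]
    omega
  suffices hV : ∀ x : V, ∃ r : Rule P A, ¬ r.IsCut ∧ r.concl = F.seq x ∧
      ∀ (j : ℕ) (hj : j < r.prems.length), GraphProvable r.prems[j] ∨
        ∃ y, F.seq y = r.prems[j] ∧ F.Step r j x y by
    obtain ⟨x, hx, -⟩ := enter S τ hS hn hτ hb ht
    exact hn (hx ▸ F.graphProvable hV x)
  rintro ⟨⟨S, τ, σ⟩, hx⟩
  obtain ⟨hS, hn, hτ, hb, ht, hσ, hsupp⟩ := id hx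
  dsimp only at hS hn hτ hb ht hσ hsupp
  cases hb with
  -- At `χ` itself, a state extending the sequent would make `χ` both true and false.
  | base =>
    obtain ⟨t, hSt⟩ := exists_state hC hS hn
    exact absurd (ht t hSt) (hχ t (hSt.2 hτ))
  | @box π φ hπ hb =>
    let x : V := ⟨(S, box π φ, σ), hx⟩
    have extend : ∀ (r : Rule P A) (j : ℕ) (T : Sequent P A), Over C T → ¬ GraphProvable T →
        Incl S T → T ≠ S → r.TraceStep j (box π φ) (box π φ) →
        ∃ y, F.seq y = T ∧ F.Step r j x y := by
      intro r j T h1 h2 h3 h4 h5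
      obtain ⟨y, rfl, h6⟩ := enter T (box π φ) h1 h2 (h3.2 hτ) (.box hπ hb)
        fun t h => ht t (h3.trans h)
      exact ⟨y, rfl, hτ, by rw [h6]; exact h5, Or.inr (Or.inl (rank_of_card x y h6 h3 h4))⟩
    -- A compound `π` is decomposed along the main focus. For an atomic `π`, the sequent is
    -- saturated before (K): left rules enlarge it, and right rules on the secondary focus enlarge
    -- it or keep sequent and main focus fixed. Once it is saturated it is a state, and (K) shortens
    -- the main focus.
    by_cases ha : ∃ a, π = atom a
    · obtain ⟨a, rfl⟩ := ha
      by_cases hl : LeftSaturated S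
      · by_cases hall : ∀ φ ∈ S.suc, Supp S φ
        · refine ⟨maximalK C S a φ, id, maximalK_concl hτ, fun j hj =>
            or_iff_not_imp_left.2 fun hj' => ?_⟩
          have hmem := List.getElem_mem hj
          obtain ⟨h1, h2⟩ := maximalK_prem_over hC hS hτ hmem
          let s : State C := ⟨S, hS, hn, hl, hall⟩
          obtain ⟨y, h3, h4⟩ := enter _ φ h1 hj' h2 hb fun t h =>
            maximalK_prem_true hC (s := s) (ht s ⟨subset_rfl, subset_rfl⟩) hmem h
          refine ⟨y, h3, hτ, ⟨rfl, h4⟩, Or.inr (Or.inl (rank_of_size x y ?_))⟩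
          rw [h4]
          change size φ < 1 + size φ
          omega
        · have hns := hsupp.resolve_left hall
          obtain ⟨r, hr⟩ := exists_rightExp hσ hns
          refine ⟨r, hr.not_isCut, hr.concl_eq, fun j hj =>
            or_iff_not_imp_left.2 fun hj' => ?_⟩
          have hmem := List.getElem_mem hj
          by_cases heq : r.prems[j] = S
          · obtain ⟨σ', h1, h2, h3, h4, -⟩ := hr.exists_focus (canonical C) hj
            refine ⟨⟨(S, _, σ'), hS, hn, hτ, .box hπ hb, ht, heq ▸ h1,
              Or.inr fun h => hns (h4 heq h)⟩, heq.symm, hτ, hr.traceStep j _, ?_⟩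
            exact Or.inr (Or.inr ⟨rfl, hσ, h2, h3⟩)
          · exact extend r j _ (hr.over hC hS hmem) hj' (hr.incl hmem) heq (hr.traceStep j _)
      · unfold LeftSaturated at hl
        push Not at hl
        obtain ⟨r, hr, hSr⟩ := hl
        refine ⟨r, hr.not_isCut, hr.concl_eq, fun j hj => or_iff_not_imp_left.2 fun hj' => ?_⟩
        have hmem := List.getElem_mem hj
        exact extend r j _ (hr.over hC hS hmem) hj' (hr.incl hmem) (fun h => hSr (h ▸ hmem))
          (hr.traceStep j _)
    · push Not at ha
      obtain ⟨r, hr⟩ := exists_rightExp_box hτ ha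
      refine ⟨r, hr.not_isCut, hr.concl_eq, fun j hj => or_iff_not_imp_left.2 fun hj' => ?_⟩
      have hmem := List.getElem_mem hj
      obtain ⟨τ', h1, h2, h3, -, h4⟩ := hr.exists_focus (canonical C) hj
      obtain ⟨h5, h6⟩ := h4 π φ rfl G χ hπ hb
      obtain ⟨y, h7, h8⟩ := enter _ τ' (hr.over hC hS hmem) hj' h1 h5 fun t h =>
        h6 t (fun ψ h9 h10 => hG ψ h10 t (h.1 h9)) (ht t ((hr.incl hmem).trans h))
      refine ⟨y, h7, hτ, by rw [h8]; exact h2, ?_⟩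
      rcases h3 with h3 | h3
      · exact Or.inl (by rw [h8]; exact h3)
      · exact Or.inr (Or.inl (rank_of_size x y (by rw [h8]; exact h3)))

/-- Induction on the support carries falsity back from the reducts. It bottoms out at `[a]φ`: were
this true at `s`, the assumption of the maximal (K) would be provable by `graphProvable_of_true`,
and so would the sequent of `s`. -/
theorem not_true_of_supp (hC : Closed C) {G : Formula P A → Prop} {χ : Formula P A}
    (hG : ∀ ψ, G ψ → ∀ t : State C, ψ ∈ t.seq.ant → (canonical C).True ψ t)
    (hχ : ∀ t : State C, Supp t.seq χ → ¬ (canonical C).True χ t) (s : State C)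
    {τ : Formula P A} (hs : Supp s.seq τ) (hb : Boxed G χ τ) : ¬ (canonical C).True τ s := by
  induction hs with
  | bot h => cases hb; exact hχ s (.bot h)
  | var h => cases hb; exact hχ s (.var h)
  | imp h1 h2 => cases hb; exact hχ s (.imp h1 h2)
  | @atom a φ h =>
    cases hb with
    | base => exact hχ s (.atom h)
    | box hπ hb =>
      intro htrue
      refine s.unprovable (maximalK_concl (C := C) h ▸
        GraphProvable.of_rule (r := maximalK C s.seq a φ) id fun j hj => ?_)
      have hmem := List.getElem_mem hj
      obtain ⟨h1, h2⟩ := maximalK_prem_over hC s.subset h hmem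
      exact graphProvable_of_true hC hG (fun t ht => hχ t (t.supp χ ht)) h1 h2 hb
        fun t ht => maximalK_prem_true hC htrue hmem ht
  | seq h ih =>
    cases hb with
    | base => exact hχ s (.seq h)
    | box hπ hb =>
      exact fun h => ih (.box hπ.1 (.box hπ.2 hb)) ((canonical C).true_box_seq.1 h)
  | ndcLeft h ih =>
    cases hb with
    | base => exact hχ s (.ndcLeft h)
    | box hπ hb => exact fun h => ih (.box hπ.1 hb) ((canonical C).true_box_ndc.1 h).1
  | ndcRight h ih =>
    cases hb with
    | base => exact hχ s (.ndcRight h)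
    | box hπ hb => exact fun h => ih (.box hπ.2 hb) ((canonical C).true_box_ndc.1 h).2
  | starExit h ih =>
    cases hb with
    | base => exact hχ s (.starExit h)
    | box hπ hb => exact fun h => ih hb ((canonical C).true_box_star.1 h).1
  | starUnfold h ih =>
    cases hb with
    | base => exact hχ s (.starUnfold h)
    | box hπ hb => exact fun h => ih (.box hπ (.box hπ hb)) ((canonical C).true_box_star.1 h).2
  | test h1 h2 ih =>
    cases hb with
    | base => exact hχ s (.test h1 h2)
    | box hπ hb => exact fun h => ih hb ((canonical C).true_box_test.1 h (hG _ hπ s h1))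

/-- The truth lemma for formulas and its counterpart for programs. -/
def TruthSpec (C : Finset (Formula P A)) : (k : Kind) → Expr P A k → Prop
  | .formula, φ => (∀ s : State C, φ ∈ s.seq.ant → (canonical C).True φ s) ∧
      ∀ s : State C, Supp s.seq φ → ¬ (canonical C).True φ s
  | .program, π =>
      TestsSatisfy (fun ψ => ∀ s : State C, ψ ∈ s.seq.ant → (canonical C).True ψ s) π ∧
      ∀ (s t : State C) (n : ℕ) (χ : Formula P A), box π χ ∈ s.seq.ant →
        (canonical C).eval π s t n → χ ∈ t.seq.ant

/-- Left saturation carries antecedent boxes along runs of programs, by induction on the run for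
stars. Nothing dual is needed for programs, as falsity of supported boxes is `not_true_of_supp`,
which needs only the truth lemma for the formula under the box and for the tests. -/
theorem truthSpec (hC : Closed C) : ∀ {k : Kind} (e : Expr P A k), TruthSpec C k e
  | _, .bot => ⟨fun s h => absurd h s.bot_notMem, fun s _ h => h 0 rfl⟩
  | _, .var p => by
    refine ⟨fun s h n hn => hn.1 h, fun s h ht => ?_⟩
    cases h with
    | var h => exact ht 0 ⟨fun h' => s.disjoint h' h, rfl⟩
  | _, .imp φ ψ => by
    obtain ⟨h1, h2⟩ := truthSpec hC φ
    obtain ⟨h3, h4⟩ := truthSpec hC ψ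
    refine ⟨fun s h => (canonical C).true_imp.2 fun hφ => ?_, fun s h ht => ?_⟩
    · have := s.leftSaturated _ (.impL h)
      simp only [Rule.prems, List.mem_cons, List.not_mem_nil, or_false, Sequent.ext_iff,
        true_and, and_true] at this
      exact this.elim (fun h5 => absurd hφ (h2 s (s.supp φ (Finset.insert_eq_self.1 h5.symm))))
        fun h5 => h3 s (Finset.insert_eq_self.1 h5.symm)
    · cases h with
      | imp h5 h6 => exact h4 s h6 ((canonical C).true_imp.1 ht (h1 s h5))
  | _, .box π φ => by
    obtain ⟨h1, h2⟩ := truthSpec hC π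
    obtain ⟨h3, h4⟩ := truthSpec hC φ
    refine ⟨fun s h => (canonical C).true_box.2 fun t n ht => h3 t (h2 s t n φ h ht), ?_⟩
    exact fun s h => not_true_of_supp hC (fun ψ hψ => hψ) h4 s h (.box h1 .base)
  | _, .atom a => ⟨trivial, fun s t n χ h h1 => h1.1 χ h⟩
  | _, .seq π₀ π₁ => by
    obtain ⟨h1, h2⟩ := truthSpec hC π₀
    obtain ⟨h3, h4⟩ := truthSpec hC π₁
    refine ⟨⟨h1, h3⟩, ?_⟩
    rintro s t n χ h ⟨x, a, b, h5, h6, -⟩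
    have := s.leftSaturated _ (.seqL h)
    simp only [Rule.prems, List.mem_cons, List.not_mem_nil, or_false, Sequent.ext_iff,
      and_true] at this
    exact h4 x t b χ (h2 s x a _ (Finset.insert_eq_self.1 this.symm) h5) h6
  | _, .ndc π₀ π₁ => by
    obtain ⟨h1, h2⟩ := truthSpec hC π₀
    obtain ⟨h3, h4⟩ := truthSpec hC π₁
    refine ⟨⟨h1, h3⟩, fun s t n χ h h5 => ?_⟩
    have := s.leftSaturated _ (.ndcL h)
    simp only [Rule.prems, List.mem_cons, List.not_mem_nil, or_false, Sequent.ext_iff,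
      and_true] at this
    rcases h5 with h5 | h5
    · exact h2 s t n χ (this ▸ by simp) h5
    · exact h4 s t n χ (this ▸ by simp) h5
  | _, .star π => by
    obtain ⟨h1, h2⟩ := truthSpec hC π
    refine ⟨h1, fun s t n χ h h5 => ?_⟩
    have key : ∀ s : State C, box (star π) χ ∈ s.seq.ant →
        χ ∈ s.seq.ant ∧ box π (box (star π) χ) ∈ s.seq.ant := by
      intro s h
      have := s.leftSaturated _ (.starL h)
      simp only [Rule.prems, List.mem_cons, List.not_mem_nil, or_false, Sequent.ext_iff,
        and_true] at this
      constructor <;> rw [this] <;> simp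
    change StarRun ((canonical C).eval π) s t n at h5
    induction h5 with
    | refl s => exact (key s h).1
    | step h6 _ ih => exact ih (h2 _ _ _ _ (key _ h).2 h6)
  | _, .test ψ => by
    obtain ⟨h1, h2⟩ := truthSpec hC ψ
    refine ⟨h1, ?_⟩
    rintro s t n χ h ⟨rfl, -, h3⟩
    have := s.leftSaturated _ (.testL h)
    simp only [Rule.prems, List.mem_cons, List.not_mem_nil, or_false, Sequent.ext_iff,
      true_and, and_true] at this
    exact this.elim (fun h5 => absurd h3 (h2 s (s.supp ψ (Finset.insert_eq_self.1 h5.symm))))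
      fun h5 => Finset.insert_eq_self.1 h5.symm

/-- Completeness of cut-free proof graphs with respect to provability. -/
theorem graphProvable_of_provable {S : Sequent P A} (h : Provable S) : GraphProvable S := by
  by_contra hn
  -- The closed set depends only on the end sequent; formulas cut in the given proof need not lie in
  -- it, as soundness holds for all formulas.
  obtain ⟨C, hC, hS⟩ := exists_closed_superset (S.ant ∪ S.suc)
  obtain ⟨t, ht⟩ := exists_state hC ⟨Finset.union_subset_left hS, Finset.union_subset_right hS⟩ hn
  refine (canonical C).not_refutes_of_provable h t ⟨fun φ hφ => ?_, fun φ hφ => ?_⟩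
  · exact (truthSpec hC φ).1 t (ht.1 hφ)
  · exact (truthSpec hC φ).2 t (t.supp φ (ht.2 hφ))

end Completeness

end CGPDL

theorem mainTheorem6 {P A : Type*} (Γ Δ : Finset (PDL.Formula P A))
    (h : CGPDL.Provable (⟨Γ, Δ⟩ : PDL.Sequent P A)) :
    CGPDL.CutFreeProvable (⟨Γ, Δ⟩ : PDL.Sequent P A) :=
  (CGPDL.graphProvable_of_provable h).cutFreeProvable
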